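/- **Theorem (Positivstellensatz, real case).** Let $d,D\ge 1$ and $k\ge 0$ be integers and let $\ell\in\{0,1,2\}$. Write $\vee^{r}\mathbb R^d\subseteq(\mathbb R^d)^{\otimes r}$ for the subspace of symmetric tensors, and for $v\in\vee^{2k}\mathbb R^d\otimes\vee^{\ell}\mathbb R^D$ put $$p_v(x,y)=\langle x^{\otimes 2k}\otimes y^{\otimes \ell},\,v\rangle\qquad(x\in\mathbb R^d,\ y\in\mathbb R^D),$$ a form of degree $2k$ in $x$ and $\ell$ in $y$. Let $m(v)$ and $M(v)$ be the minimum and the maximum of $p_v(x,y)$ over $\|x\|=\|y\|=1$, and suppose that $m(v)>0$. Let $n\ge k$ be an integer such that $$2n\ \ge\ \frac{dk(2k-1)}{\ln\left(1+\frac{m(v)}{M(v)}\right)}+2-2k-d,$$ or, in the case $k=1$, only such that $$2n\ \ge\ d\,\frac{M(v)}{m(v)}-d .$$ Then there is $\tilde v\in\vee^{2k}\mathbb R^d\otimes\vee^{\ell}\mathbb R^D$ such that $p_{\tilde v}(\phi,y)\ge 0$ for all $\phi\in\mathbb R^d$, $y\in\mathbb R^D$, and $$\|x\|^{2(n-k)}\,p_v(x,y)=\int_{\mathcal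 S^{d-1}_{\mathbb R}}p_{\tilde v}(\phi,y)\,\langle\phi,x\rangle^{2n}\,\mathrm d\phi\qquad\text{for all }x\in\mathbb R^d,\ y\in\mathbb R^D,$$ where $\mathrm d\phi$ is the uniform probability measure on the unit sphere $\mathcal S^{d-1}_{\mathbb R}$ of $\mathbb R^d$. Moreover, $\|x\|^{2(n-k)}p_v(x,y)$ is a sum of squares, that is, a finite sum of squares of real polynomials in the coordinates of $x$ and $y$. -/

import Mathlib

open MeasureTheory
open scoped TensorProduct

namespace RealPSS

noncomputable section

/-- `ℝ^d` with its Euclidean inner product. -/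
abbrev E (d : ℕ) : Type := EuclideanSpace ℝ (Fin d)

/-- The symmetric subspace `∨ⁿ ℝ^d` of `(ℝ^d)^{⊗ n}`: the tensors that are invariant under all
permutations of the `n` tensor factors. -/
def Sym (n d : ℕ) : Submodule ℝ (⨂[ℝ]^n (E d)) where
  carrier := {t | ∀ σ : Equiv.Perm (Fin n),
    PiTensorProduct.reindex ℝ (fun _ : Fin n => E d) σ t = t}
  add_mem' := fun {a b} ha hb σ => by rw [map_add, ha σ, hb σ]
  zero_mem' := fun σ => map_zero _
  smul_mem' := fun c a ha σ => by rw [map_smul, ha σ]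

/-- The functional `t ↦ ⟨x^{⊗ n}, t⟩` on `(ℝ^d)^{⊗ n}`, that is
`a₁ ⊗ ⋯ ⊗ aₙ ↦ ⟨x, a₁⟩ ⋯ ⟨x, aₙ⟩`. -/
def bra (n : ℕ) {d : ℕ} (x : E d) : (⨂[ℝ]^n (E d)) →ₗ[ℝ] ℝ :=
  PiTensorProduct.lift
    ((MultilinearMap.mkPiAlgebra ℝ (Fin n) ℝ).compLinearMap fun _ => innerₗ (E d) x)

/-- The form `p_v(x, y) = ⟨x^{⊗ r} ⊗ y^{⊗ l}, v⟩` of a tensor `v ∈ ∨^r ℝ^d ⊗ ∨^l ℝ^D`. -/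
def p {r l d D : ℕ} (v : Sym r d ⊗[ℝ] Sym l D) (x : E d) (y : E D) : ℝ :=
  LinearMap.mul' ℝ ℝ
    (TensorProduct.map (bra r x ∘ₗ (Sym r d).subtype) (bra l y ∘ₗ (Sym l D).subtype) v)

/-- The values of `p_v` on pairs of unit vectors. -/
def sphereValues {r l d D : ℕ} (v : Sym r d ⊗[ℝ] Sym l D) : Set ℝ :=
  {s | ∃ (x : E d) (y : E D), ‖x‖ = 1 ∧ ‖y‖ = 1 ∧ s = p v x y}

/-- `m(v)`: the minimum of `p_v` over the product of the unit spheres. -/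
def m {r l d D : ℕ} (v : Sym r d ⊗[ℝ] Sym l D) : ℝ := sInf (sphereValues v)

/-- `M(v)`: the maximum of `p_v` over the product of the unit spheres. -/
def M {r l d D : ℕ} (v : Sym r d ⊗[ℝ] Sym l D) : ℝ := sSup (sphereValues v)

/-- The uniform (rotation invariant) probability measure on the unit sphere of `ℝ^d`:
the surface measure, normalized to total mass one. -/
def uniformSphere (d : ℕ) : Measure (Metric.sphere (0 : E d) 1) :=
  ((volume : Measure (E d)).toSphere Set.univ)⁻¹ • (volume : Measure (E d)).toSphere

/-- A function of `(x, y) ∈ ℝ^d × ℝ^D` is a sum of squares if it is a finite sum of squares of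
real polynomials in the coordinates of `x` and `y`. -/
def IsSumOfSquares {d D : ℕ} (f : E d → E D → ℝ) : Prop :=
  ∃ (N : ℕ) (s : Fin N → MvPolynomial (Fin d ⊕ Fin D) ℝ),
    ∀ (x : E d) (y : E D),
      f x y = ∑ i, (MvPolynomial.eval (Sum.elim (fun a => x a) (fun b => y b)) (s i)) ^ 2

end

end RealPSS

/-!
Fix `y`. The form `f = p_v(·, y)` has degree `2k`, and the moment map
`g ↦ ∫ g(φ) ⟨φ, x⟩^{2n} dφ` sends forms of degree `2k` to `‖x‖^{2(n-k)}` times forms of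
degree `2k`. It is inverted explicitly, and `v'` is the preimage of `v`; what has to be shown
is that the preimage of `f` is nonnegative on the sphere.

* The moment map. A cubature formula (`exists_cubature`, from the compactness of the convex hull of
  the image of the sphere under the monomials) replaces the integral by a finite sum
  `∑ w_c g(z_c) ⟨z_c, x⟩^{2n}`, so that identities can be differentiated formally. The case `g = 1` is a multiple of a power of `‖x‖²` by
  rotation invariance, with the constant found by applying the Laplacian (`momentMap_one`), and
  differentiating in `x` gives Hobson's formula (`momentMap_eq_hobson`): the moment map is a
  combination of the operators `‖x‖^{2j} Δ^j`.
* The inverse. It is a multiple of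
  `f ↦ ∑_i (-1)^i / (4^i i! L (L-1) ⋯ (L-i+1)) ‖x‖^{2i} Δ^i f` with `L = n + k + d/2 - 1`; since
  `‖φ‖ = 1` on the sphere, Hobson's formula applies to every `Δ^i f`, and the coefficients
  cancel by the binomial theorem (`momentMap_invMoment`).
* Positivity. Banach's theorem on symmetric multilinear forms (`abs_multilinear_le_of_diag`) gives
  Kellogg's inequality `|∂_i f| ≤ 2k max |f|` on the sphere, hence bounds for all `Δ^i f`. With
  `a = d k (2k-1) / (2n + 2k + d - 2)` the terms `i ≥ 1` of the inverse are at most `M a^i / i!` in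
  absolute value, so that the inverse is at least `m - M (exp a - 1)`, which is nonnegative by the
  hypothesis on `n` (`eval_invMoment_nonneg`). For `k = 1` there is a single correction term
  and it is estimated directly (`eval_invMoment_nonneg_of_quadratic`).

For the sum of squares, the cubature formula is applied to the integral representation: in each
of the finitely many summands, `p_{v'}(z_c, ·)` is a nonnegative form of degree at most two, hence a
sum of squares (`exists_sq_of_nonneg`), and `⟨z_c, x⟩^{2n}` is a square.
-/

namespace RealPSS

/-! ### Norms of symmetric multilinear forms -/

section Banach

variable {V : Type*} [NormedAddCommGroup V] [InnerProductSpace ℝ V] {s : ℕ}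

/-- A bound for a multilinear form on unit vectors extends to all vectors by homogeneity. -/
lemma abs_multilinear_le_of_unit {F : MultilinearMap ℝ (fun _ : Fin s => V) ℝ} {L : ℝ}
    (hF : ∀ x : Fin s → V, (∀ i, ‖x i‖ = 1) → |F x| ≤ L) (x : Fin s → V) :
    |F x| ≤ L * ∏ i, ‖x i‖ := by
  by_cases h : ∃ i, x i = 0
  · obtain ⟨i, hi⟩ := h
    rw [F.map_coord_zero i hi, Finset.prod_eq_zero (Finset.mem_univ i) (by simp [hi])]
    simp
  · push Not at h
    have hx : x = fun i => ‖x i‖ • (‖x i‖⁻¹ • x i) := by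
      funext i
      rw [smul_smul, mul_inv_cancel₀ (norm_ne_zero_iff.2 (h i)), one_smul]
    have hu := hF (fun i => ‖x i‖⁻¹ • x i) fun i => by
      rw [norm_smul, norm_inv, norm_norm, inv_mul_cancel₀ (norm_ne_zero_iff.2 (h i))]
    have h0 : 0 ≤ ∏ i, ‖x i‖ := Finset.prod_nonneg fun i _ => norm_nonneg _
    conv_lhs => rw [hx]
    rw [F.map_smul_univ, smul_eq_mul, abs_mul, abs_of_nonneg h0, mul_comm]
    gcongr

/-- If a symmetric bilinear form of norm at most `L` takes the value `±L` at a pair of unit vectors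
`u`, `v`, then it takes the value `±L` at the direction of `u + v`, taken twice. -/
lemma abs_bilin_add_self_ge {B : V → V → ℝ} {L : ℝ} {u v : V}
    (hadd : ∀ a b c, B (a + b) c = B a c + B b c) (hsub : ∀ a b c, B (a - b) c = B a c - B b c)
    (hsymm : ∀ a b, B a b = B b a) (hB : ∀ a b, |B a b| ≤ L * (‖a‖ * ‖b‖))
    (hu : ‖u‖ = 1) (hv : ‖v‖ = 1) (huv : |B u v| = L) :
    L * ‖u + v‖ ^ 2 ≤ |B (u + v) (u + v)| := by
  have hpol : B (u + v) (u + v) - B (u - v) (u - v) = 4 * B u v := by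
    have h1 : B (u + v) (u + v) = B u u + 2 * B u v + B v v := by
      rw [hadd, hsymm u, hsymm v, hadd, hadd, hsymm v u]; ring
    have h2 : B (u - v) (u - v) = B u u - 2 * B u v + B v v := by
      rw [hsub, hsymm u, hsymm v, hsub, hsub, hsymm v u]; ring
    rw [h1, h2]; ring
  have hpar := parallelogram_law_with_norm ℝ u v
  rw [hu, hv] at hpar
  have h1 := hB (u - v) (u - v)
  have h2 : 4 * |B u v| ≤ |B (u + v) (u + v)| + |B (u - v) (u - v)| := by
    rw [← abs_of_pos (show (0 : ℝ) < 4 by norm_num), ← abs_mul, ← hpol]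
    exact abs_sub _ _
  rw [huv] at h2
  have h3 : L * ‖u + v‖ ^ 2 + L * ‖u - v‖ ^ 2 = 4 * L := by rw [← mul_add, hpar]; ring
  linarith [(by ring : L * (‖u - v‖ * ‖u - v‖) = L * ‖u - v‖ ^ 2)]

/-- **Banach's theorem**: the norm of a symmetric multilinear form on a Euclidean space is attained
on the diagonal. Among all tuples of unit vectors at which `|F|` is maximal, one for which the
sum of the vectors is longest has all its entries equal: replacing two distinct entries `u`, `v` by
the direction of `u + v` would keep `|F|` maximal and lengthen the sum. -/
theorem abs_multilinear_le_of_diag [FiniteDimensional ℝ V] [Nontrivial V]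
    {F : MultilinearMap ℝ (fun _ : Fin s => V) ℝ} (hcont : Continuous F)
    (hsymm : ∀ (σ : Equiv.Perm (Fin s)) (x : Fin s → V), F (fun i => x (σ i)) = F x) {C : ℝ}
    (hC : ∀ u : V, ‖u‖ = 1 → |F fun _ => u| ≤ C) (x : Fin s → V) :
    |F x| ≤ C * ∏ i, ‖x i‖ := by
  refine abs_multilinear_le_of_unit (fun x hx => ?_) x
  let K : Set (Fin s → V) := Set.univ.pi fun _ => Metric.sphere 0 1
  have hK : IsCompact K := isCompact_univ_pi fun _ => isCompact_sphere _ _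
  have hKmem : ∀ z : Fin s → V, z ∈ K ↔ ∀ i, ‖z i‖ = 1 := fun z => by simp [K]
  obtain ⟨y, hyK, hy⟩ := hK.exists_isMaxOn ⟨x, (hKmem x).2 hx⟩ hcont.abs.continuousOn
  set L := |F y| with hL
  have hL0 : 0 ≤ L := abs_nonneg _
  have hbound : ∀ z : Fin s → V, |F z| ≤ L * ∏ i, ‖z i‖ :=
    abs_multilinear_le_of_unit fun z hz => hy ((hKmem z).2 hz)
  let K' : Set (Fin s → V) := K ∩ {z | |F z| = L}
  have hK' : IsCompact K' := hK.inter_right (isClosed_eq hcont.abs continuous_const)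
  obtain ⟨z, hzK', hz⟩ := hK'.exists_isMaxOn (f := fun z : Fin s → V => ‖∑ i, z i‖)
    ⟨y, hyK, rfl⟩ (by fun_prop)
  have hz1 := (hKmem z).1 hzK'.1
  have hzL : |F z| = L := hzK'.2
  set S := ∑ i, z i with hS
  have hupd : ∀ (i : Fin s) (a : V), ∑ k, Function.update z i a k = S + (a - z i) := by
    intro i a
    rw [Finset.sum_update_of_mem (Finset.mem_univ i), hS,
      ← Finset.add_sum_erase _ z (Finset.mem_univ i), Finset.sdiff_singleton_eq_erase]
    abel
  -- Reversing the sign of one entry cannot lengthen the sum.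
  have hinner : ∀ i, 1 ≤ inner ℝ S (z i) := by
    intro i
    have hmem : Function.update z i (-z i) ∈ K' := by
      refine ⟨(hKmem _).2 fun k => ?_, ?_⟩
      · rcases eq_or_ne k i with rfl | hk
        · simp [hz1]
        · simp [hk, hz1]
      · have : Function.update z i (-z i) = Function.update z i ((-1 : ℝ) • z i) := by simp
        change |F _| = L
        rw [this, F.map_update_smul, Function.update_eq_self]
        simpa using hzL
    have h1 : ‖∑ k, Function.update z i (-z i) k‖ ≤ ‖S‖ := hz hmem
    rw [hupd] at h1
    have h2 : ‖S + (-z i - z i)‖ ^ 2 ≤ ‖S‖ ^ 2 := by gcongr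
    have h3 : S + (-z i - z i) = S - (2 : ℝ) • z i := by rw [two_smul]; abel
    rw [h3, norm_sub_sq_real, norm_smul, inner_smul_right, hz1] at h2
    norm_num at h2
    linarith
  have hall : ∀ i j, z i = z j := by
    intro i j
    by_contra hne
    have hij : i ≠ j := fun h => hne (by rw [h])
    set u := z i with hu
    set v := z j with hv
    let B : V → V → ℝ := fun a b => F (Function.update (Function.update z i a) j b)
    have hcomm : ∀ a b, Function.update (Function.update z i a) j b =
        Function.update (Function.update z j b) i a := fun a b =>
      Function.update_comm hij a b z
    have hBsymm : ∀ a b, B a b = B b a := by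
      intro a b
      simp only [B]
      rw [← hsymm (Equiv.swap i j)]
      congr 1
      funext k
      rcases eq_or_ne k i with rfl | hki
      · simp [hij]
      rcases eq_or_ne k j with rfl | hkj
      · simp [hij]
      · rw [Equiv.swap_apply_of_ne_of_ne hki hkj]; simp [hki, hkj]
    have hB : ∀ a b, |B a b| ≤ L * (‖a‖ * ‖b‖) := by
      intro a b
      refine (hbound _).trans_eq ?_
      congr 1
      rw [Finset.prod_eq_mul i j hij]
      · simp [hij]
      · intro k _ hk; simp [hk.1, hk.2, hz1]
      · simp
      · simp
    have hBuv : |B u v| = L := by simp [B, hu, hv, hzL]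
    have hge := abs_bilin_add_self_ge (u := u) (v := v)
      (fun a b c => by simp only [B, hcomm, F.map_update_add])
      (fun a b c => by simp only [B, hcomm, F.map_update_sub]) hBsymm hB (hz1 i) (hz1 j) hBuv
    have hSuv : 2 ≤ inner ℝ S (u + v) := by
      rw [inner_add_right]; linarith [hinner i, hinner j]
    have huv0 : u + v ≠ 0 := by
      intro h; rw [h, inner_zero_right] at hSuv; norm_num at hSuv
    have hpos : 0 < ‖u + v‖ := norm_pos_iff.2 huv0
    set r := ‖u + v‖ with hr
    set w := r⁻¹ • (u + v) with hw
    have hw1 : ‖w‖ = 1 := by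
      rw [hw, norm_smul, norm_inv, norm_norm, ← hr, inv_mul_cancel₀ hpos.ne']
    have hBw : |B w w| = L := by
      apply le_antisymm
      · simpa [hw1] using hB w w
      · have : B w w = r⁻¹ ^ 2 * B (u + v) (u + v) := by
          simp only [B, hw, F.map_update_smul, hcomm, smul_eq_mul]
          rw [← hcomm, F.map_update_smul, hcomm, smul_eq_mul]; ring
        rw [this, abs_mul, abs_of_nonneg (by positivity), inv_pow, ← div_eq_inv_mul,
          le_div_iff₀ (by positivity)]
        exact hge
    have hmem : Function.update (Function.update z i w) j w ∈ K' := by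
      refine ⟨(hKmem _).2 fun k => ?_, hBw⟩
      rcases eq_or_ne k j with rfl | hkj
      · simp [hw1]
      rcases eq_or_ne k i with rfl | hki
      · simp [hkj, hw1]
      · simp [hkj, hki, hz1]
    have h1 : ‖∑ k, Function.update (Function.update z i w) j w k‖ ≤ ‖S‖ := hz hmem
    have h2 : ∑ k, Function.update (Function.update z i w) j w k =
        S + (2 * r⁻¹ - 1) • (u + v) := by
      rw [Finset.sum_update_of_mem (Finset.mem_univ j), Finset.sdiff_singleton_eq_erase]
      have h3 := hupd i w
      rw [← Finset.add_sum_erase _ _ (Finset.mem_univ j), Function.update_of_ne hij.symm] at h3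
      have h4 : ∑ k ∈ Finset.univ.erase j, Function.update z i w k = S + (w - u) - v := by
        rw [← h3]; abel
      rw [h4, sub_smul, mul_smul, ← hw, two_smul, one_smul]
      abel
    have hr2 : r < 2 := by
      have hpar := parallelogram_law_with_norm ℝ u v
      have h5 : 0 < ‖u - v‖ := norm_pos_iff.2 (sub_ne_zero.2 hne)
      rw [hz1 i, hz1 j, ← hr] at hpar
      nlinarith
    have hc : 0 < 2 * r⁻¹ - 1 := by
      rw [sub_pos, ← div_eq_mul_inv, lt_div_iff₀ hpos]; linarith
    rw [h2] at h1
    have h6 : ‖S + (2 * r⁻¹ - 1) • (u + v)‖ ^ 2 ≤ ‖S‖ ^ 2 := by gcongr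
    rw [norm_add_sq_real, inner_smul_right] at h6
    nlinarith [sq_nonneg ‖(2 * r⁻¹ - 1) • (u + v)‖, mul_pos hc (show (0 : ℝ) < 2 by norm_num)]
  have hdiag : ∃ a : V, ‖a‖ = 1 ∧ z = fun _ => a := by
    rcases Nat.eq_zero_or_pos s with rfl | hs
    · obtain ⟨a, ha⟩ := exists_norm_eq V zero_le_one
      exact ⟨a, ha, Subsingleton.elim _ _⟩
    · exact ⟨z ⟨0, hs⟩, hz1 _, funext fun i => hall _ _⟩
  obtain ⟨a, ha, rfl⟩ := hdiag
  exact (hy ((hKmem x).2 hx)).trans (hzL.symm.le.trans (hC a ha))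

end Banach

/-! ### Symmetric tensors as homogeneous polynomials -/

section Tensors

open MvPolynomial

variable {n d : ℕ}

/-- The linear form `x ↦ ⟨a, x⟩` as a polynomial in the coordinates of `x`. -/
noncomputable def linPoly (d : ℕ) : E d →ₗ[ℝ] MvPolynomial (Fin d) ℝ where
  toFun a := ∑ i, C (a i) * X i
  map_add' a b := by simp [add_mul, Finset.sum_add_distrib]
  map_smul' c a := by simp [Finset.smul_sum, smul_eq_C_mul, mul_assoc]

lemma linPoly_apply (a : E d) : linPoly d a = ∑ i, C (a i) * X i := rfl

lemma eval_linPoly (a x : E d) : eval x.ofLp (linPoly d a) = inner ℝ a x := by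
  simp [linPoly_apply, PiLp.inner_apply, mul_comm]

lemma linPoly_single (i : Fin d) : linPoly d (EuclideanSpace.single i 1) = X i := by
  rw [linPoly_apply, Finset.sum_eq_single i]
  · simp
  · intro j _ hj; simp [hj]
  · simp

lemma isHomogeneous_linPoly (a : E d) : (linPoly d a).IsHomogeneous 1 :=
  IsHomogeneous.sum _ _ _ fun _ _ => isHomogeneous_C_mul_X _ _

lemma pderiv_linPoly (a : E d) (i : Fin d) : pderiv i (linPoly d a) = C (a i) := by
  rw [linPoly_apply, map_sum, Finset.sum_eq_single i]
  · simp
  · intro j _ hj; simp [pderiv_X_of_ne hj]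
  · simp

/-- The polynomial `x ↦ ⟨x^{⊗ n}, t⟩` of a tensor `t`. -/
noncomputable def toPoly (n d : ℕ) : (⨂[ℝ]^n (E d)) →ₗ[ℝ] MvPolynomial (Fin d) ℝ :=
  PiTensorProduct.lift
    ((MultilinearMap.mkPiAlgebra ℝ (Fin n) (MvPolynomial (Fin d) ℝ)).compLinearMap
      fun _ => linPoly d)

lemma toPoly_tprod (a : Fin n → E d) :
    toPoly n d (PiTensorProduct.tprod ℝ a) = ∏ i, linPoly d (a i) := by
  simp [toPoly]

lemma bra_tprod (x : E d) (a : Fin n → E d) :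
    bra n x (PiTensorProduct.tprod ℝ a) = ∏ i, inner ℝ x (a i) := by
  simp [bra]

lemma eval_toPoly (x : E d) (t : ⨂[ℝ]^n (E d)) : eval x.ofLp (toPoly n d t) = bra n x t := by
  induction t using PiTensorProduct.induction_on with
  | smul_tprod r a =>
    rw [map_smul, smul_eval, map_smul, smul_eq_mul, toPoly_tprod, bra_tprod, map_prod]
    simp [eval_linPoly, real_inner_comm]
  | add a b ha hb => rw [map_add, map_add, map_add, ha, hb]

lemma isHomogeneous_toPoly (t : ⨂[ℝ]^n (E d)) : (toPoly n d t).IsHomogeneous n := by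
  induction t using PiTensorProduct.induction_on with
  | smul_tprod r a =>
    rw [map_smul, toPoly_tprod, smul_eq_C_mul]
    refine IsHomogeneous.C_mul ?_ r
    simpa using IsHomogeneous.prod Finset.univ (fun i => linPoly d (a i)) (fun _ => 1)
      fun i _ => isHomogeneous_linPoly _
  | add a b ha hb => rw [map_add]; exact ha.add hb

lemma toPoly_reindex (σ : Equiv.Perm (Fin n)) (t : ⨂[ℝ]^n (E d)) :
    toPoly n d (PiTensorProduct.reindex ℝ (fun _ : Fin n => E d) σ t) = toPoly n d t := by
  induction t using PiTensorProduct.induction_on with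
  | smul_tprod r a =>
    rw [map_smul, map_smul, map_smul, PiTensorProduct.reindex_tprod]
    erw [toPoly_tprod]
    rw [toPoly_tprod]
    congr 1
    exact Equiv.prod_comp σ.symm fun i => linPoly d (a i)
  | add a b ha hb => rw [map_add, map_add, map_add, ha, hb]

/-- The multilinear form `(x₁, …, xₙ) ↦ ⟨x₁ ⊗ ⋯ ⊗ xₙ, t⟩` of a tensor `t`. -/
noncomputable def polar (n d : ℕ) :
    (⨂[ℝ]^n (E d)) →ₗ[ℝ] MultilinearMap ℝ (fun _ : Fin n => E d) ℝ :=
  PiTensorProduct.lift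
    (((LinearMap.applyₗ (MultilinearMap.mkPiAlgebra ℝ (Fin n) ℝ)).compMultilinearMap
      MultilinearMap.compLinearMapMultilinear).compLinearMap fun _ => innerₗ (E d))

lemma polar_tprod (a x : Fin n → E d) :
    polar n d (PiTensorProduct.tprod ℝ a) x = ∏ i, inner ℝ (a i) (x i) := by
  simp [polar]

lemma polar_reindex (σ : Equiv.Perm (Fin n)) (t : ⨂[ℝ]^n (E d)) (x : Fin n → E d) :
    polar n d (PiTensorProduct.reindex ℝ (fun _ : Fin n => E d) σ t) x =
      polar n d t fun i => x (σ i) := by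
  induction t using PiTensorProduct.induction_on with
  | smul_tprod r a =>
    rw [map_smul, map_smul, map_smul, PiTensorProduct.reindex_tprod, smul_apply,
      smul_apply]
    erw [polar_tprod]
    rw [polar_tprod]
    congr 1
    refine (Equiv.prod_comp σ fun i => (inner ℝ (a (σ.symm i)) (x i) : ℝ)).symm.trans ?_
    exact Finset.prod_congr rfl fun i _ =>
      congrArg (fun k => (inner ℝ (a k) (x (σ i)) : ℝ)) (σ.symm_apply_apply i)
  | add a b ha hb => simp only [map_add, add_apply, ha, hb]

lemma polar_symm {t : ⨂[ℝ]^n (E d)} (ht : t ∈ Sym n d) (σ : Equiv.Perm (Fin n))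
    (x : Fin n → E d) : polar n d t (fun i => x (σ i)) = polar n d t x := by
  rw [← polar_reindex, ht σ]

lemma polar_diag (t : ⨂[ℝ]^n (E d)) (x : E d) :
    polar n d t (fun _ => x) = eval x.ofLp (toPoly n d t) := by
  induction t using PiTensorProduct.induction_on with
  | smul_tprod r a =>
    rw [map_smul, map_smul, smul_eval, toPoly_tprod, smul_apply, polar_tprod,
      map_prod]
    simp [eval_linPoly]
  | add a b ha hb => simp only [map_add, add_apply, ha, hb]

lemma continuous_polar (t : ⨂[ℝ]^n (E d)) : Continuous (polar n d t) := by
  induction t using PiTensorProduct.induction_on with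
  | smul_tprod r a =>
    have : ⇑(polar n d (r • PiTensorProduct.tprod ℝ a)) =
        fun x => r * ∏ i, inner ℝ (a i) (x i) := by
      funext x
      rw [map_smul, smul_apply, polar_tprod, smul_eq_mul]
    rw [this]
    fun_prop
  | add a b ha hb =>
    rw [map_add]
    exact ha.add hb

lemma pderiv_prod {ι : Type*} [DecidableEq ι] (s : Finset ι) (f : ι → MvPolynomial (Fin d) ℝ)
    (i : Fin d) : pderiv i (∏ j ∈ s, f j) = ∑ j ∈ s, pderiv i (f j) * ∏ k ∈ s.erase j, f k := by
  induction s using Finset.induction_on with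
  | empty => simp
  | insert a s ha ih =>
    rw [Finset.prod_insert ha, pderiv_mul, ih, Finset.sum_insert ha, Finset.erase_insert ha,
      Finset.mul_sum]
    congr 1
    refine Finset.sum_congr rfl fun j hj => ?_
    have hja : a ≠ j := fun h => ha (h ▸ hj)
    rw [Finset.erase_insert_of_ne hja, Finset.prod_insert (by simp [ha])]
    ring

/-- Partial derivatives of the form of a tensor, in terms of its multilinear form. -/
lemma eval_pderiv_toPoly (t : ⨂[ℝ]^n (E d)) (x : E d) (i : Fin d) :
    eval x.ofLp (pderiv i (toPoly n d t)) =
      ∑ j, polar n d t (Function.update (fun _ => x) j (EuclideanSpace.single i 1)) := by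
  induction t using PiTensorProduct.induction_on with
  | smul_tprod r a =>
    rw [map_smul, Derivation.map_smul, smul_eval, map_smul, toPoly_tprod, pderiv_prod, map_sum,
      Finset.mul_sum]
    refine Finset.sum_congr rfl fun j _ => ?_
    rw [smul_apply, polar_tprod, smul_eq_mul, map_mul, map_prod, pderiv_linPoly,
      ← Finset.mul_prod_erase Finset.univ _ (Finset.mem_univ j)]
    congr 2
    · simp [EuclideanSpace.inner_single_right]
    · refine Finset.prod_congr rfl fun k hk => ?_
      rw [Function.update_of_ne (Finset.ne_of_mem_erase hk), eval_linPoly]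
  | add a b ha hb =>
    simp only [map_add, add_apply, ha, hb, Finset.sum_add_distrib]

/-- The symmetrization of a tensor: the average of its images under permutations of the factors. -/
noncomputable def symmetrize (t : ⨂[ℝ]^n (E d)) : ⨂[ℝ]^n (E d) :=
  ((Nat.factorial n : ℝ)⁻¹) •
    ∑ σ : Equiv.Perm (Fin n), PiTensorProduct.reindex ℝ (fun _ : Fin n => E d) σ t

lemma symmetrize_mem (t : ⨂[ℝ]^n (E d)) : symmetrize t ∈ Sym n d := by
  intro τ
  rw [symmetrize, map_smul, map_sum]
  congr 1
  refine Fintype.sum_equiv (Equiv.mulLeft τ) _ _ fun σ => ?_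
  exact PiTensorProduct.reindex_reindex (R := ℝ) (s := fun _ : Fin n => E d) σ τ t

lemma toPoly_symmetrize (t : ⨂[ℝ]^n (E d)) : toPoly n d (symmetrize t) = toPoly n d t := by
  rw [symmetrize, map_smul, map_sum]
  simp only [toPoly_reindex]
  rw [Finset.sum_const, Finset.card_univ, Fintype.card_perm, Fintype.card_fin,
    ← Nat.cast_smul_eq_nsmul ℝ, smul_smul, inv_mul_cancel₀ (by positivity), one_smul]

lemma exists_prod_X_eq_monomial (m : Fin d →₀ ℕ) (hm : m.degree = n) :
    ∃ c : Fin n → Fin d, ∏ j, (X (c j) : MvPolynomial (Fin d) ℝ) = monomial m 1 := by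
  induction n generalizing m with
  | zero =>
    rw [Finsupp.degree_eq_zero_iff] at hm
    exact ⟨Fin.elim0, by simp [hm]⟩
  | succ n ih =>
    have hne : m ≠ 0 := by rintro rfl; simp at hm
    obtain ⟨i, hi⟩ := Finsupp.ne_iff.1 hne
    have hle : Finsupp.single i 1 ≤ m := by
      rw [Finsupp.single_le_iff]; exact Nat.one_le_iff_ne_zero.2 hi
    have hsplit : m = Finsupp.single i 1 + (m - Finsupp.single i 1) := by
      rw [add_tsub_cancel_of_le hle]
    obtain ⟨c, hc⟩ := ih (m - Finsupp.single i 1) (by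
      have := congrArg Finsupp.degree hsplit
      rw [map_add, hm, Finsupp.degree_single] at this
      omega)
    refine ⟨Fin.cons i c, ?_⟩
    rw [Fin.prod_univ_succ]
    simp only [Fin.cons_zero, Fin.cons_succ]
    rw [hc, X, monomial_mul, ← hsplit, one_mul]

/-- Every form of degree `n` is the form of a symmetric tensor. -/
lemma exists_toPoly_eq {P : MvPolynomial (Fin d) ℝ} (hP : P.IsHomogeneous n) :
    ∃ t ∈ Sym n d, toPoly n d t = P := by
  suffices h : P ∈ (Sym n d).map (toPoly n d) by
    simpa [Submodule.mem_map] using h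
  rw [P.as_sum]
  refine Submodule.sum_mem _ fun m hm => ?_
  have hdeg : m.degree = n := by
    by_contra hne
    exact (mem_support_iff.1 hm) (hP.coeff_eq_zero hne)
  obtain ⟨c, hc⟩ := exists_prod_X_eq_monomial m hdeg
  have : monomial m (coeff m P) = coeff m P • ∏ j, (X (c j) : MvPolynomial (Fin d) ℝ) := by
    rw [hc, smul_monomial, smul_eq_mul, mul_one]
  rw [this]
  refine Submodule.smul_mem _ _ ⟨_, symmetrize_mem
    (PiTensorProduct.tprod ℝ fun j => EuclideanSpace.single (c j) 1), ?_⟩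
  rw [toPoly_symmetrize, toPoly_tprod]
  simp only [linPoly_single]

/-- A linear operator on forms of degree `n` lifts to symmetric tensors. -/
lemma exists_symMap (T : MvPolynomial (Fin d) ℝ →ₗ[ℝ] MvPolynomial (Fin d) ℝ)
    (hT : ∀ P : MvPolynomial (Fin d) ℝ, P.IsHomogeneous n → (T P).IsHomogeneous n) :
    ∃ S : Sym n d →ₗ[ℝ] Sym n d, ∀ t : Sym n d,
      toPoly n d (S t : ⨂[ℝ]^n (E d)) = T (toPoly n d (t : ⨂[ℝ]^n (E d))) := by
  let f : Sym n d →ₗ[ℝ] homogeneousSubmodule (Fin d) ℝ n :=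
    ((toPoly n d) ∘ₗ (Sym n d).subtype).codRestrict _ fun t => isHomogeneous_toPoly _
  let g : Sym n d →ₗ[ℝ] homogeneousSubmodule (Fin d) ℝ n :=
    (T ∘ₗ (toPoly n d) ∘ₗ (Sym n d).subtype).codRestrict _ fun t =>
      hT _ (isHomogeneous_toPoly _)
  have hf : Function.Surjective f := by
    rintro ⟨P, hP⟩
    obtain ⟨t, ht, rfl⟩ := exists_toPoly_eq hP
    exact ⟨⟨t, ht⟩, rfl⟩
  obtain ⟨S, hS⟩ := Module.projective_lifting_property f g hf
  refine ⟨S, fun t => ?_⟩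
  have := congrArg Subtype.val (LinearMap.congr_fun hS t)
  exact this

/-! ### The contractions of a biform -/

variable {r l D : ℕ}

/-- The contraction of `v` with `y^{⊗ l}` in the second factor: the form `p_v(·, y)`. -/
noncomputable def contrRight (r d : ℕ) {l D : ℕ} (y : E D) :
    (Sym r d ⊗[ℝ] Sym l D) →ₗ[ℝ] Sym r d :=
  (TensorProduct.rid ℝ (Sym r d)).toLinearMap ∘ₗ
    TensorProduct.map LinearMap.id (bra l y ∘ₗ (Sym l D).subtype)

/-- The contraction of `v` with `x^{⊗ r}` in the first factor: the form `p_v(x, ·)`. -/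
noncomputable def contrLeft (l D : ℕ) {r d : ℕ} (x : E d) :
    (Sym r d ⊗[ℝ] Sym l D) →ₗ[ℝ] Sym l D :=
  (TensorProduct.lid ℝ (Sym l D)).toLinearMap ∘ₗ
    TensorProduct.map (bra r x ∘ₗ (Sym r d).subtype) LinearMap.id

lemma p_eq_eval_contrRight (v : Sym r d ⊗[ℝ] Sym l D) (x : E d) (y : E D) :
    p v x y = eval x.ofLp (toPoly r d (contrRight r d y v : ⨂[ℝ]^r (E d))) := by
  rw [eval_toPoly]
  induction v using TensorProduct.induction_on with
  | zero => simp [p]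
  | tmul a b => simp [p, contrRight, mul_comm]
  | add a b ha hb =>
    rw [map_add, Submodule.coe_add, map_add, ← ha, ← hb]
    simp [p]

lemma p_eq_eval_contrLeft (v : Sym r d ⊗[ℝ] Sym l D) (x : E d) (y : E D) :
    p v x y = eval y.ofLp (toPoly l D (contrLeft l D x v : ⨂[ℝ]^l (E D))) := by
  rw [eval_toPoly]
  induction v using TensorProduct.induction_on with
  | zero => simp [p]
  | tmul a b => simp [p, contrLeft]
  | add a b ha hb =>
    rw [map_add, Submodule.coe_add, map_add, ← ha, ← hb]
    simp [p]

lemma contrRight_map (S : Sym r d →ₗ[ℝ] Sym r d) (y : E D) (v : Sym r d ⊗[ℝ] Sym l D) :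
    contrRight r d y (TensorProduct.map S LinearMap.id v) = S (contrRight r d y v) := by
  induction v using TensorProduct.induction_on with
  | zero => simp
  | tmul a b => simp [contrRight]
  | add a b ha hb => rw [map_add, map_add, map_add, map_add, ha, hb]

end Tensors

section Laplacian

open MvPolynomial

variable {d : ℕ}

/-! ### The Laplacian of polynomials -/

lemma pderiv_comm (i j : Fin d) (P : MvPolynomial (Fin d) ℝ) :
    pderiv i (pderiv j P) = pderiv j (pderiv i P) := by
  induction P using MvPolynomial.induction_on with
  | C a => simp
  | add p q hp hq => simp only [map_add, hp, hq]
  | mul_X p k hp =>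
    have h : ∀ a b : Fin d, pderiv a (pderiv b (X k : MvPolynomial (Fin d) ℝ)) = 0 := by
      intro a b
      rcases eq_or_ne k b with rfl | hk
      · rw [pderiv_X_self, pderiv_one]
      · rw [pderiv_X_of_ne hk, map_zero]
    simp only [pderiv_mul, map_add, hp, h]
    ring

/-- The Laplacian `∑ᵢ ∂ᵢ²` on polynomials. -/
noncomputable def lap (d : ℕ) : Module.End ℝ (MvPolynomial (Fin d) ℝ) :=
  ∑ i : Fin d, (pderiv i).toLinearMap ∘ₗ (pderiv i).toLinearMap

/-- The polynomial `x ↦ ‖x‖²`. -/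
noncomputable def rsq (d : ℕ) : MvPolynomial (Fin d) ℝ := ∑ i, X i ^ 2

lemma lap_apply (P : MvPolynomial (Fin d) ℝ) : lap d P = ∑ i, pderiv i (pderiv i P) := by
  simp [lap]

lemma eval_rsq (x : E d) : eval x.ofLp (rsq d) = ‖x‖ ^ 2 := by
  simp [rsq, EuclideanSpace.norm_sq_eq]

lemma isHomogeneous_rsq : (rsq d).IsHomogeneous 2 :=
  IsHomogeneous.sum _ _ _ fun i _ => isHomogeneous_X_pow i 2

lemma pderiv_rsq (i : Fin d) : pderiv i (rsq d) = 2 * X i := by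
  rw [rsq, map_sum, Finset.sum_eq_single i]
  · rw [pderiv_pow, pderiv_X_self]; norm_num
  · intro j _ hj; rw [pderiv_pow, pderiv_X_of_ne hj, mul_zero]
  · simp

lemma pderiv_lap (i : Fin d) (P : MvPolynomial (Fin d) ℝ) :
    pderiv i (lap d P) = lap d (pderiv i P) := by
  simp only [lap_apply, map_sum]
  exact Finset.sum_congr rfl fun j _ => by rw [pderiv_comm i j, pderiv_comm i j]

lemma pderiv_lap_pow (i : Fin d) (j : ℕ) (P : MvPolynomial (Fin d) ℝ) :
    pderiv i ((lap d ^ j) P) = (lap d ^ j) (pderiv i P) := by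
  induction j generalizing P with
  | zero => rfl
  | succ j ih => rw [pow_succ, Module.End.mul_apply, Module.End.mul_apply, ih, pderiv_lap]

lemma lap_X_mul (i : Fin d) (P : MvPolynomial (Fin d) ℝ) :
    lap d (X i * P) = X i * lap d P + 2 * pderiv i P := by
  have h : ∀ k, pderiv k (pderiv k (X i * P)) =
      X i * pderiv k (pderiv k P) + if k = i then 2 * pderiv i P else 0 := by
    intro k
    split_ifs with hk
    · subst hk
      simp only [pderiv_mul, pderiv_X_self, map_add, pderiv_one]
      ring
    · simp only [pderiv_mul, pderiv_X_of_ne (Ne.symm hk), map_add, map_zero]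
      ring
  simp only [lap_apply, h, Finset.sum_add_distrib, Finset.mul_sum]
  simp

lemma lap_pow_X_mul (i : Fin d) (j : ℕ) (P : MvPolynomial (Fin d) ℝ) :
    (lap d ^ (j + 1)) (X i * P) =
      X i * (lap d ^ (j + 1)) P + (2 * (j + 1) : ℝ) • (lap d ^ j) (pderiv i P) := by
  induction j with
  | zero =>
    simp only [zero_add, pow_one, pow_zero, Module.End.one_apply, lap_X_mul]
    rw [smul_eq_C_mul]; simp [← map_ofNat (C : ℝ →+* MvPolynomial (Fin d) ℝ) 2]
  | succ j ih =>
    rw [pow_succ' (lap d) (j + 1), Module.End.mul_apply, ih, map_add, map_smul, lap_X_mul,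
      Module.End.mul_apply, pow_succ' (lap d) j, Module.End.mul_apply, Module.End.mul_apply,
      pderiv_lap, pderiv_lap_pow, smul_eq_C_mul, smul_eq_C_mul]
    push_cast
    simp only [map_mul, map_add, map_ofNat, map_natCast, map_one]
    ring

lemma isHomogeneous_lap {s : ℕ} {P : MvPolynomial (Fin d) ℝ} (hP : P.IsHomogeneous s) :
    (lap d P).IsHomogeneous (s - 2) := by
  rw [lap_apply]
  exact IsHomogeneous.sum _ _ _ fun i _ => hP.pderiv.pderiv

lemma lap_eq_zero {s : ℕ} {P : MvPolynomial (Fin d) ℝ} (hP : P.IsHomogeneous s) (hs : s < 2) :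
    lap d P = 0 := by
  rw [lap_apply]
  refine Finset.sum_eq_zero fun i _ => ?_
  have h : (pderiv i P).IsHomogeneous 0 := by
    have := hP.pderiv (i := i)
    rwa [show s - 1 = 0 by omega] at this
  rw [← totalDegree_zero_iff_isHomogeneous, totalDegree_eq_zero_iff_eq_C] at h
  rw [h, pderiv_C]

lemma isHomogeneous_lap_pow {s : ℕ} {P : MvPolynomial (Fin d) ℝ} (hP : P.IsHomogeneous s)
    (j : ℕ) : ((lap d ^ j) P).IsHomogeneous (s - 2 * j) := by
  induction j generalizing s P with
  | zero => simpa using hP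
  | succ j ih =>
    rw [pow_succ, Module.End.mul_apply, show s - 2 * (j + 1) = s - 2 - 2 * j by omega]
    exact ih (isHomogeneous_lap hP)

lemma lap_pow_eq_zero {s : ℕ} {P : MvPolynomial (Fin d) ℝ} (hP : P.IsHomogeneous s) {j : ℕ}
    (hs : s < 2 * j) : (lap d ^ j) P = 0 := by
  induction j generalizing s P with
  | zero => omega
  | succ j ih =>
    rw [pow_succ, Module.End.mul_apply]
    by_cases h : s < 2
    · rw [lap_eq_zero hP h, map_zero]
    · exact ih (isHomogeneous_lap hP) (by omega)

lemma lap_rsq_pow (N : ℕ) :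
    lap d (rsq d ^ (N + 1)) = C (2 * (N + 1) * (2 * N + d) : ℝ) * rsq d ^ N := by
  have h : ∀ i : Fin d, pderiv i (pderiv i (rsq d ^ (N + 1))) =
      C (2 * (N + 1) : ℝ) * rsq d ^ N + C (4 * (N + 1) * N : ℝ) * (rsq d ^ (N - 1) * X i ^ 2) := by
    intro i
    simp only [pderiv_pow, pderiv_rsq, pderiv_mul, Nat.add_sub_cancel, map_natCast, pderiv_X_self,
      map_mul, map_add, map_one, map_ofNat]
    have h2 : pderiv i (2 : MvPolynomial (Fin d) ℝ) = 0 := by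
      rw [← map_ofNat (C : ℝ →+* MvPolynomial (Fin d) ℝ) 2, pderiv_C]
    have h3 : pderiv i (((N + 1 : ℕ) : MvPolynomial (Fin d) ℝ)) = 0 := by
      rw [← map_natCast (C : ℝ →+* MvPolynomial (Fin d) ℝ), pderiv_C]
    rw [h2, h3]
    push_cast
    ring
  rw [lap_apply, Finset.sum_congr rfl fun i _ => h i, Finset.sum_add_distrib, Finset.sum_const,
    ← Finset.mul_sum, ← Finset.mul_sum, ← rsq]
  rcases N with _ | N
  · simp; ring
  · simp only [Nat.add_sub_cancel, Finset.card_univ, Fintype.card_fin, nsmul_eq_mul, map_mul,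
      map_add, map_natCast, map_ofNat, map_one]
    push_cast
    ring

lemma lap_linPoly_pow (a : E d) (N : ℕ) :
    lap d (linPoly d a ^ (N + 2)) = C ((N + 2) * (N + 1) * ‖a‖ ^ 2 : ℝ) * linPoly d a ^ N := by
  have h : ∀ i : Fin d, pderiv i (pderiv i (linPoly d a ^ (N + 2))) =
      C ((N + 2) * (N + 1) * (a i) ^ 2 : ℝ) * linPoly d a ^ N := by
    intro i
    rw [pderiv_pow, pderiv_linPoly, ← map_natCast (C : ℝ →+* MvPolynomial (Fin d) ℝ), mul_assoc,
      pderiv_C_mul, mul_comm (linPoly d a ^ _), pderiv_C_mul, pderiv_pow, pderiv_linPoly]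
    rw [show N + 2 - 1 - 1 = N by omega, show N + 2 - 1 = N + 1 by omega]
    push_cast
    simp only [map_mul, map_add, map_natCast, map_ofNat, map_one, map_pow]
    ring
  rw [lap_apply, Finset.sum_congr rfl fun i _ => h i, ← Finset.sum_mul, ← map_sum,
    ← Finset.mul_sum, EuclideanSpace.norm_sq_eq]
  simp

/-! ### Kellogg's bounds for derivatives of forms -/

/-- **Kellogg's inequality**: a partial derivative of a form of degree `s` is bounded on the unit
sphere by `s` times the bound of the form. -/
lemma abs_eval_pderiv_le {s : ℕ} {P : MvPolynomial (Fin d) ℝ} (hP : P.IsHomogeneous s) {B : ℝ}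
    (hB : ∀ x : E d, ‖x‖ = 1 → |eval x.ofLp P| ≤ B) (i : Fin d) (x : E d) (hx : ‖x‖ = 1) :
    |eval x.ofLp (pderiv i P)| ≤ s * B := by
  obtain ⟨t, ht, rfl⟩ := exists_toPoly_eq hP
  have : Nontrivial (E d) := by
    refine ⟨⟨x, 0, ?_⟩⟩
    rintro rfl
    simp at hx
  rw [eval_pderiv_toPoly]
  refine (Finset.abs_sum_le_sum_abs _ _).trans ?_
  have h : ∀ j : Fin s, |polar s d t
      (Function.update (fun _ => x) j (EuclideanSpace.single i 1))| ≤ B := by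
    intro j
    refine (abs_multilinear_le_of_diag (continuous_polar t) (fun σ y => polar_symm ht σ y)
      (C := B) (fun u hu => by rw [polar_diag]; exact hB u hu) _).trans_eq ?_
    rw [Finset.prod_eq_one, mul_one]
    intro k _
    rcases eq_or_ne k j with rfl | hk
    · simp
    · simp [hk, hx]
  refine (Finset.sum_le_sum fun j _ => h j).trans_eq ?_
  simp

lemma abs_eval_lap_le {s : ℕ} {P : MvPolynomial (Fin d) ℝ} (hP : P.IsHomogeneous s) {B : ℝ}
    (hB : ∀ x : E d, ‖x‖ = 1 → |eval x.ofLp P| ≤ B) (x : E d) (hx : ‖x‖ = 1) :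
    |eval x.ofLp (lap d P)| ≤ d * ((s - 1 : ℕ) * (s * B)) := by
  rw [lap_apply, map_sum]
  refine (Finset.abs_sum_le_sum_abs _ _).trans ?_
  refine (Finset.sum_le_sum fun i _ =>
    abs_eval_pderiv_le hP.pderiv (abs_eval_pderiv_le hP hB i) i x hx).trans_eq ?_
  simp

end Laplacian

/-! ### The uniform measure on the sphere and cubature -/

section Caratheodory

/-- In finite dimension the convex hull of a compact set is compact: by Carathéodory's theorem it
is a finite union of continuous images of compact sets. -/
lemma isCompact_convexHull_of_isCompact {V : Type*} [NormedAddCommGroup V] [NormedSpace ℝ V]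
    [FiniteDimensional ℝ V] {K : Set V} (hK : IsCompact K) : IsCompact (convexHull ℝ K) := by
  let f : ∀ n : ℕ, (Fin n → ℝ) × (Fin n → V) → V := fun n q => ∑ i, q.1 i • q.2 i
  have hEq : convexHull ℝ K = ⋃ n ∈ Finset.range (Module.finrank ℝ V + 2),
      f n '' (stdSimplex ℝ (Fin n) ×ˢ Set.univ.pi fun _ => K) := by
    ext x
    simp only [Set.mem_iUnion, Finset.mem_range, exists_prop]
    constructor
    · intro hx
      obtain ⟨ι, _, z, w, hz, hind, hw, hw1, rfl⟩ := eq_pos_convex_span_of_mem_convexHull hx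
      refine ⟨Fintype.card ι, ?_, ?_⟩
      · have := hind.card_le_finrank_succ
        have h2 := Submodule.finrank_le (vectorSpan ℝ (Set.range z))
        omega
      · let e := Fintype.equivFin ι
        refine ⟨(w ∘ e.symm, z ∘ e.symm), ⟨⟨fun i => (hw _).le, ?_⟩, fun i _ => ?_⟩, ?_⟩
        · simpa using (Equiv.sum_comp e.symm w).trans hw1
        · exact hz ⟨_, rfl⟩
        · exact Equiv.sum_comp e.symm fun i => w i • z i
    · rintro ⟨n, -, ⟨w, z⟩, ⟨hw, hz⟩, rfl⟩
      exact mem_convexHull_of_exists_fintype w z hw.1 hw.2 (fun i => hz i trivial) rfl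
  rw [hEq]
  refine Finset.isCompact_biUnion _ fun n _ => ?_
  refine ((isCompact_stdSimplex _ _).prod (isCompact_univ_pi fun _ => hK)).image ?_
  fun_prop

end Caratheodory

section Sphere

open MvPolynomial

variable {d : ℕ}

lemma isProbabilityMeasure_uniformSphere (hd : 1 ≤ d) :
    IsProbabilityMeasure (uniformSphere d) := by
  have : Nonempty (Fin d) := ⟨⟨0, hd⟩⟩
  have hne : (volume : Measure (E d)).toSphere Set.univ ≠ 0 := by
    rw [Measure.measure_univ_ne_zero]
    exact Measure.toSphere_ne_zero _
  refine ⟨?_⟩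
  rw [uniformSphere, Measure.smul_apply, smul_eq_mul,
    ENNReal.inv_mul_cancel hne (measure_ne_top _ _)]

/-- The action of a linear isometry on the unit sphere. -/
noncomputable def sphereMap (U : E d ≃ₗᵢ[ℝ] E d) (φ : Metric.sphere (0 : E d) 1) :
    Metric.sphere (0 : E d) 1 :=
  ⟨U φ, by simp⟩

lemma continuous_sphereMap (U : E d ≃ₗᵢ[ℝ] E d) : Continuous (sphereMap U) :=
  Continuous.subtype_mk (U.continuous.comp continuous_subtype_val) _

open scoped Pointwise in
lemma toSphere_map (U : E d ≃ₗᵢ[ℝ] E d) :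
    (volume : Measure (E d)).toSphere.map (sphereMap U) = (volume : Measure (E d)).toSphere := by
  ext s hs
  have hm := (continuous_sphereMap U).measurable
  rw [Measure.map_apply hm hs, Measure.toSphere_apply' _ (hm hs), Measure.toSphere_apply' _ hs]
  congr 1
  have hpres : MeasurePreserving U.toMeasurableEquiv (volume : Measure (E d)) volume :=
    U.measurePreserving
  rw [← hpres.measure_preimage_equiv (Set.Ioo (0 : ℝ) 1 •
    (Subtype.val '' s))]
  congr 1
  ext x
  simp only [Set.mem_smul, Set.mem_image, Set.mem_preimage]
  constructor
  · rintro ⟨t, ht, y, ⟨φ, hφ, rfl⟩, rfl⟩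
    exact ⟨t, ht, _, ⟨sphereMap U φ, hφ, rfl⟩, by simp [sphereMap]⟩
  · rintro ⟨t, ht, y, ⟨φ, hφ, rfl⟩, h⟩
    refine ⟨t, ht, _, ⟨sphereMap U.symm φ, ?_, rfl⟩, ?_⟩
    · have : sphereMap U (sphereMap U.symm φ) = φ := Subtype.ext (by simp [sphereMap])
      rw [this]; exact hφ
    · apply U.injective
      have h' : t • (φ : E d) = U x := h
      simp [sphereMap, h']

lemma integral_sphereMap (U : E d ≃ₗᵢ[ℝ] E d) {f : Metric.sphere (0 : E d) 1 → ℝ}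
    (hf : Continuous f) :
    ∫ φ, f (sphereMap U φ) ∂(uniformSphere d) = ∫ φ, f φ ∂(uniformSphere d) := by
  rw [uniformSphere, integral_smul_measure, integral_smul_measure]
  congr 1
  conv_rhs => rw [← toSphere_map U]
  rw [integral_map (continuous_sphereMap U).aemeasurable hf.aestronglyMeasurable]

/-- The moment `∫ ⟨φ, x⟩^N dφ` depends on the norm of `x` only. -/
lemma integral_inner_pow_eq_of_norm_eq {x y : E d} (h : ‖x‖ = ‖y‖) (N : ℕ) :
    ∫ φ : Metric.sphere (0 : E d) 1, (inner ℝ (φ : E d) x) ^ N ∂(uniformSphere d) =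
      ∫ φ : Metric.sphere (0 : E d) 1, (inner ℝ (φ : E d) y) ^ N ∂(uniformSphere d) := by
  let U : E d ≃ₗᵢ[ℝ] E d := (ℝ ∙ (x - y))ᗮ.reflection
  have hU : U x = y := Submodule.reflection_sub h
  rw [← hU, ← integral_sphereMap U (f := fun φ => (inner ℝ (φ : E d) (U x)) ^ N) (by fun_prop)]
  simp only [sphereMap, LinearIsometryEquiv.inner_map_map]

lemma exists_integral_inner_pow (hd : 1 ≤ d) (N : ℕ) :
    ∃ c : ℝ, ∀ x : E d,
      ∫ φ : Metric.sphere (0 : E d) 1, (inner ℝ (φ : E d) x) ^ N ∂(uniformSphere d) =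
        c * ‖x‖ ^ N := by
  have : Nonempty (Fin d) := ⟨⟨0, hd⟩⟩
  obtain ⟨e, he⟩ := exists_norm_eq (E d) zero_le_one
  refine ⟨∫ φ : Metric.sphere (0 : E d) 1, (inner ℝ (φ : E d) e) ^ N ∂(uniformSphere d),
    fun x => ?_⟩
  rw [integral_inner_pow_eq_of_norm_eq (x := x) (y := ‖x‖ • e) (by simp [norm_smul, he])]
  simp only [inner_smul_right, mul_pow, integral_const_mul]
  ring

/-- **Cubature**: the integral of polynomials of bounded degree over the sphere is a finite
convex combination of point evaluations. -/
lemma exists_cubature (hd : 1 ≤ d) (N : ℕ) :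
    ∃ (ι : Type) (_ : Fintype ι) (w : ι → ℝ) (z : ι → E d), (∀ c, 0 ≤ w c) ∧ ∑ c, w c = 1 ∧
      (∀ c, ‖z c‖ = 1) ∧ ∀ P : MvPolynomial (Fin d) ℝ, P.totalDegree ≤ N →
        ∫ φ : Metric.sphere (0 : E d) 1, eval (φ : E d).ofLp P ∂(uniformSphere d) =
          ∑ c, w c * eval (z c).ofLp P := by
  have := isProbabilityMeasure_uniformSphere hd
  -- The moment map lists the values of all monomials of degree at most `N` in each variable.
  let Ψ : Metric.sphere (0 : E d) 1 → ((Fin d → Fin (N + 1)) → ℝ) :=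
    fun φ a => ∏ i, (φ : E d) i ^ (a i : ℕ)
  have hΨ : Continuous Ψ := by fun_prop
  have hcomp : IsCompact (Set.range Ψ) := isCompact_range hΨ
  have hint : Integrable Ψ (uniformSphere d) :=
    hΨ.integrable_of_hasCompactSupport (HasCompactSupport.of_compactSpace _)
  have hmem : ∫ φ, Ψ φ ∂(uniformSphere d) ∈ convexHull ℝ (Set.range Ψ) :=
    (convex_convexHull ℝ _).integral_mem (isCompact_convexHull_of_isCompact hcomp).isClosed
      (Filter.Eventually.of_forall fun φ => subset_convexHull ℝ _ ⟨φ, rfl⟩) hint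
  obtain ⟨ι, hι, w, u, hw0, hw1, hu, hsum⟩ := mem_convexHull_iff_exists_fintype.1 hmem
  choose z hz using hu
  refine ⟨ι, hι, w, fun c => z c, hw0, hw1, fun c => by simp, fun P hP => ?_⟩
  have hmon : ∀ m ∈ P.support, ∃ a : Fin d → Fin (N + 1), ∀ i, (a i : ℕ) = m i := by
    intro m hm
    have h : ∀ i, m i < N + 1 := fun i => Nat.lt_succ_of_le
      (((m.le_degree i).trans (le_totalDegree hm)).trans hP)
    exact ⟨fun i => ⟨m i, h i⟩, fun i => rfl⟩
  choose! a ha using hmon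
  have hev : ∀ φ : Metric.sphere (0 : E d) 1,
      eval (φ : E d).ofLp P = ∑ m ∈ P.support, coeff m P * Ψ φ (a m) := by
    intro φ
    rw [eval_eq']
    refine Finset.sum_congr rfl fun m hm => ?_
    simp only [Ψ, ha m hm]
  have hΨi : ∀ b, Integrable (fun φ => Ψ φ b) (uniformSphere d) := fun b => hint.eval b
  simp only [hev]
  rw [integral_finsetSum _ fun m _ => (hΨi _).const_mul _]
  simp only [integral_const_mul, Finset.mul_sum]
  rw [Finset.sum_comm]
  refine Finset.sum_congr rfl fun m _ => ?_
  have h := congrFun hsum (a m)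
  rw [eval_integral hΨi] at h
  rw [← h, Finset.sum_apply, Finset.mul_sum]
  refine Finset.sum_congr rfl fun c _ => ?_
  rw [Pi.smul_apply, smul_eq_mul, ← hz]
  ring

end Sphere

section Moments

open MvPolynomial

variable {d : ℕ} {ι : Type*} [Fintype ι]

/-! ### Moments of a form against powers of linear forms -/

/-- The constants `∏_{i < N} 1 / (4 i + 2 d)`; the `2N`-th moment of the uniform measure on the
sphere is `(2N)! / N!` times the `N`-th of them. -/
noncomputable def momentConst (d N : ℕ) : ℝ := ∏ i ∈ Finset.range N, (4 * i + 2 * d : ℝ)⁻¹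

lemma momentConst_pos (hd : 1 ≤ d) (N : ℕ) : 0 < momentConst d N :=
  Finset.prod_pos fun i _ => by positivity

lemma momentConst_succ (N : ℕ) :
    momentConst d (N + 1) = momentConst d N * (4 * N + 2 * d : ℝ)⁻¹ := Finset.prod_range_succ _ _

/-- The map `g ↦ ∑_c w_c g(z_c) ⟨z_c, ·⟩^m`, a cubature version of `∫ g(φ) ⟨φ, ·⟩^m dφ`. -/
noncomputable def momentMap (w : ι → ℝ) (z : ι → E d) (m : ℕ) :
    MvPolynomial (Fin d) ℝ →ₗ[ℝ] MvPolynomial (Fin d) ℝ :=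
  ∑ c, w c • (MvPolynomial.aeval (z c).ofLp).toLinearMap.smulRight (linPoly d (z c) ^ m)

lemma momentMap_apply (w : ι → ℝ) (z : ι → E d) (m : ℕ) (g : MvPolynomial (Fin d) ℝ) :
    momentMap w z m g = ∑ c, (w c * eval (z c).ofLp g) • linPoly d (z c) ^ m := by
  simp [momentMap, smul_smul]

/-- If the even moments of the nodes are multiples of powers of `‖x‖²`, then the multiples are those
of the uniform measure: applying the Laplacian, which lowers `N` by one, determines them. -/
lemma momentMap_one {w : ι → ℝ} {z : ι → E d} (hd : 1 ≤ d) (hw : ∑ c, w c = 1)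
    (hz : ∀ c, ‖z c‖ = 1) {N₀ : ℕ}
    (hmom : ∀ N ≤ N₀, ∃ c : ℝ, momentMap w z (2 * N) 1 = c • rsq d ^ N) {N : ℕ} (hN : N ≤ N₀) :
    momentMap w z (2 * N) 1 =
      ((2 * N).factorial / N.factorial * momentConst d N : ℝ) • rsq d ^ N := by
  induction N with
  | zero => simp [momentMap_apply, momentConst, ← Finset.sum_smul, hw]
  | succ N ih =>
    obtain ⟨c, hc⟩ := hmom (N + 1) hN
    have hlap := congrArg (lap d) hc
    have hL : lap d (momentMap w z (2 * (N + 1)) 1) =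
        ((2 * N + 2) * (2 * N + 1) : ℝ) • momentMap w z (2 * N) 1 := by
      rw [momentMap_apply, momentMap_apply, map_sum, Finset.smul_sum]
      refine Finset.sum_congr rfl fun i _ => ?_
      rw [map_smul, show 2 * (N + 1) = 2 * N + 2 by ring, lap_linPoly_pow, hz, ← smul_eq_C_mul,
        smul_comm]
      push_cast
      simp
    rw [hL, ih (by omega), map_smul, lap_rsq_pow, ← smul_eq_C_mul, smul_smul, smul_smul] at hlap
    have : Nonempty (Fin d) := ⟨⟨0, hd⟩⟩
    obtain ⟨e, he⟩ := exists_norm_eq (E d) zero_le_one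
    have hev := congrArg (eval e.ofLp) hlap
    rw [smul_eval, smul_eval, map_pow, eval_rsq, he] at hev
    simp only [one_pow, mul_one] at hev
    rw [hc, momentConst_succ]
    congr 1
    have h1 : (((2 * (N + 1)).factorial : ℕ) : ℝ) =
        (2 * N + 2) * ((2 * N + 1) * (2 * N).factorial) := by
      rw [show 2 * (N + 1) = 2 * N + 1 + 1 by ring, Nat.factorial_succ, Nat.factorial_succ]
      push_cast; ring
    have h2 : (((N + 1).factorial : ℕ) : ℝ) = (N + 1) * N.factorial := by
      rw [Nat.factorial_succ]; push_cast; ring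
    have hd' : (1 : ℝ) ≤ d := by exact_mod_cast hd
    have h3 : (2 * N + d : ℝ) ≠ 0 := by positivity
    have h4 : (N.factorial : ℝ) ≠ 0 := by positivity
    rw [h1, h2]
    have h5 : (4 * N + 2 * d : ℝ) = 2 * (2 * N + d) := by ring
    rw [h5]
    field_simp at hev ⊢
    linarith

/-- The right-hand side of Hobson's formula, without its constant: the operator
`∑_j 2^s 4^{-j} / ((a + j)! j!) ‖x‖^{2 (a + j)} Δ^j`. -/
noncomputable def hobson (d s a J : ℕ) : MvPolynomial (Fin d) ℝ →ₗ[ℝ] MvPolynomial (Fin d) ℝ :=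
  ∑ j ∈ Finset.range J, (2 ^ s / 4 ^ j / ((a + j).factorial * j.factorial) : ℝ) •
    (LinearMap.mulLeft ℝ (rsq d ^ (a + j)) ∘ₗ (lap d ^ j))

lemma hobson_apply (s a J : ℕ) (g : MvPolynomial (Fin d) ℝ) :
    hobson d s a J g = ∑ j ∈ Finset.range J,
      (2 ^ s / 4 ^ j / ((a + j).factorial * j.factorial) : ℝ) •
        (rsq d ^ (a + j) * (lap d ^ j) g) := by
  simp [hobson]

lemma pderiv_hobson {s a J : ℕ} (i : Fin d) {g : MvPolynomial (Fin d) ℝ}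
    (hg : g.IsHomogeneous s) (hJ : s + 1 < 2 * J) :
    pderiv i (hobson d s (a + 1) J g) = hobson d (s + 1) a J (X i * g) := by
  obtain ⟨J, rfl⟩ : ∃ K, J = K + 1 := ⟨J - 1, by omega⟩
  have hlast : (lap d ^ J) (pderiv i g) = 0 := by
    rcases Nat.eq_zero_or_pos s with rfl | hs
    · rw [← totalDegree_zero_iff_isHomogeneous, totalDegree_eq_zero_iff_eq_C] at hg
      rw [hg, pderiv_C, map_zero]
    · exact lap_pow_eq_zero hg.pderiv (by omega)
  rw [hobson_apply, hobson_apply, map_sum]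
  have hL : ∀ j, pderiv i ((2 ^ s / 4 ^ j / ((a + 1 + j).factorial * j.factorial) : ℝ) •
      (rsq d ^ (a + 1 + j) * (lap d ^ j) g)) =
      (2 ^ (s + 1) / 4 ^ j / ((a + j).factorial * j.factorial) : ℝ) •
        (rsq d ^ (a + j) * (X i * (lap d ^ j) g)) +
      (2 ^ s / 4 ^ j / ((a + 1 + j).factorial * j.factorial) : ℝ) •
        (rsq d ^ (a + 1 + j) * (lap d ^ j) (pderiv i g)) := by
    intro j
    rw [Derivation.map_smul, pderiv_mul, pderiv_lap_pow, smul_add, pderiv_pow, pderiv_rsq]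
    congr 1
    have h1 : (((a + 1 + j).factorial : ℕ) : ℝ) = (a + 1 + j : ℕ) * (a + j).factorial := by
      rw [show a + 1 + j = a + j + 1 by ring, Nat.factorial_succ]; push_cast; ring
    have h2 : (2 ^ (s + 1) / 4 ^ j / ((a + j).factorial * j.factorial) : ℝ) =
        2 ^ s / 4 ^ j / ((a + 1 + j).factorial * j.factorial) * (2 * (a + 1 + j : ℕ)) := by
      have h3 : (((a + 1 + j : ℕ)) : ℝ) ≠ 0 := by positivity
      rw [h1]
      field_simp
      ring
    rw [h2, ← smul_smul]
    congr 1
    rw [show a + 1 + j - 1 = a + j by omega, smul_eq_C_mul, map_mul, map_natCast, map_ofNat]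
    ring
  simp only [hL]
  rw [Finset.sum_add_distrib, Finset.sum_range_succ (fun j => (2 ^ s / 4 ^ j / _ : ℝ) • _) J, hlast,
    mul_zero, smul_zero, add_zero, Finset.sum_range_succ', Finset.sum_range_succ' _ J]
  simp only [lap_pow_X_mul, mul_add, smul_add]
  rw [Finset.sum_add_distrib, add_right_comm]
  congr 2
  refine Finset.sum_congr rfl fun j _ => ?_
  rw [show a + (j + 1) = a + 1 + j by ring, mul_smul_comm, smul_smul]
  congr 1
  rw [Nat.factorial_succ]
  push_cast
  field_simp
  ring

/-- **Hobson's formula**, in the form of an expansion of the moments of a form `g` of degree `s`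
against a power of linear forms: it is obtained from the case `g = 1` by differentiating, since
`∂_i` of the moment of `g` is a multiple of the moment of `X_i g`. -/
theorem momentMap_eq_hobson {w : ι → ℝ} {z : ι → E d} {N : ℕ}
    (hmom : momentMap w z (2 * N) 1 =
      ((2 * N).factorial / N.factorial * momentConst d N : ℝ) • rsq d ^ N)
    {s J : ℕ} (hs : s ≤ N) (hJ : s < 2 * J) {g : MvPolynomial (Fin d) ℝ}
    (hg : g.IsHomogeneous s) :
    momentMap w z (2 * N - s) g =
      ((2 * N - s).factorial * momentConst d N : ℝ) • hobson d s (N - s) J g := by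
  induction s generalizing g with
  | zero =>
    rw [← totalDegree_zero_iff_isHomogeneous, totalDegree_eq_zero_iff_eq_C] at hg
    rw [hg, ← mul_one (C _), ← smul_eq_C_mul, map_smul, map_smul, smul_comm]
    congr 1
    obtain ⟨J, rfl⟩ : ∃ K, J = K + 1 := ⟨J - 1, by omega⟩
    rw [Nat.sub_zero, hmom, hobson_apply, Finset.sum_range_succ', Finset.sum_eq_zero]
    · simp only [zero_add, pow_zero, Module.End.one_apply, smul_smul, Nat.sub_zero, mul_one,
        add_zero, Nat.factorial_zero]
      congr 1
      push_cast
      ring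
    · intro j _
      rw [lap_pow_eq_zero (isHomogeneous_one (Fin d) ℝ) (by omega), mul_zero, smul_zero]
  | succ s ih =>
    have hstep : ∀ (i : Fin d) {q : MvPolynomial (Fin d) ℝ}, q.IsHomogeneous s →
        momentMap w z (2 * N - (s + 1)) (X i * q) = ((2 * N - (s + 1)).factorial *
          momentConst d N : ℝ) • hobson d (s + 1) (N - (s + 1)) J (X i * q) := by
      intro i q hq
      have h := congrArg (pderiv i) (ih (by omega) (by omega) hq)
      obtain ⟨m, hm⟩ : ∃ m, 2 * N - s = m + 1 := ⟨2 * N - s - 1, by omega⟩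
      have hL : pderiv i (momentMap w z (m + 1) q) =
          (m + 1 : ℝ) • momentMap w z m (X i * q) := by
        rw [momentMap_apply, momentMap_apply, map_sum, Finset.smul_sum]
        refine Finset.sum_congr rfl fun c _ => ?_
        rw [Derivation.map_smul, pderiv_pow, pderiv_linPoly, map_mul, eval_X, smul_eq_C_mul,
          smul_eq_C_mul, smul_eq_C_mul, Nat.add_sub_cancel]
        push_cast
        simp only [map_mul, map_add, map_natCast, map_one]
        ring
      rw [hm, hL, Derivation.map_smul, show N - s = N - (s + 1) + 1 by omega,
        pderiv_hobson i hq hJ, Nat.factorial_succ] at h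
      have hm1 : (m + 1 : ℝ) ≠ 0 := by positivity
      rw [show 2 * N - (s + 1) = m by omega]
      apply smul_right_injective _ hm1
      simp only
      rw [h, smul_smul]
      congr 1
      push_cast
      ring
    -- Euler's identity writes `g` as a combination of the products `X_i ∂_i g`.
    have heuler := hg.sum_X_mul_pderiv
    have hg' : g = ((s : ℝ) + 1)⁻¹ • ∑ i, X i * pderiv i g := by
      rw [heuler, ← Nat.cast_smul_eq_nsmul ℝ, smul_smul]
      push_cast
      rw [inv_mul_cancel₀ (by positivity), one_smul]
    rw [hg', map_smul, map_smul, map_sum, map_sum, smul_comm]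
    congr 1
    rw [Finset.smul_sum]
    exact Finset.sum_congr rfl fun i _ => hstep i hg.pderiv

/-! ### The inverse of the moment map -/

/-- The `i`-th coefficient of the inverse of the moment map on forms of degree `2k`, where
`N = n + k`. -/
noncomputable def invCoeff (d N i : ℕ) : ℝ :=
  momentConst d N / (momentConst d (N - i) * i.factorial)

/-- Up to a constant, the inverse of the moment map on forms of degree `2k`. -/
noncomputable def invMoment (d k N : ℕ) : MvPolynomial (Fin d) ℝ →ₗ[ℝ] MvPolynomial (Fin d) ℝ :=
  ∑ i ∈ Finset.range (k + 1), ((-1) ^ i * invCoeff d N i) •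
    (LinearMap.mulLeft ℝ (rsq d ^ i) ∘ₗ (lap d ^ i))

lemma invMoment_apply (k N : ℕ) (f : MvPolynomial (Fin d) ℝ) :
    invMoment d k N f = ∑ i ∈ Finset.range (k + 1), ((-1) ^ i * invCoeff d N i) •
      (rsq d ^ i * (lap d ^ i) f) := by
  simp [invMoment]

lemma isHomogeneous_invMoment {k N : ℕ} {f : MvPolynomial (Fin d) ℝ}
    (hf : f.IsHomogeneous (2 * k)) : (invMoment d k N f).IsHomogeneous (2 * k) := by
  rw [invMoment_apply]
  refine IsHomogeneous.sum _ _ _ fun i hi => ?_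
  rw [smul_eq_C_mul]
  refine IsHomogeneous.C_mul ?_ _
  have h := (isHomogeneous_rsq.pow i).mul (isHomogeneous_lap_pow hf i)
  rwa [show 2 * i + (2 * k - 2 * i) = 2 * k by have := Finset.mem_range.1 hi; omega] at h

lemma sum_neg_one_pow_div_factorial {t : ℕ} (ht : t ≠ 0) :
    ∑ i ∈ Finset.range (t + 1), ((-1) ^ i / (i.factorial * (t - i).factorial) : ℝ) = 0 := by
  have h := Int.alternating_sum_range_choose_of_ne ht
  have h' : ∑ i ∈ Finset.range (t + 1), ((-1) ^ i * (t.choose i : ℝ)) = 0 := by exact_mod_cast h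
  have h2 : ∀ i ∈ Finset.range (t + 1), ((-1) ^ i / (i.factorial * (t - i).factorial) : ℝ) =
      (t.factorial : ℝ)⁻¹ * ((-1) ^ i * (t.choose i : ℝ)) := by
    intro i hi
    rw [Nat.cast_choose ℝ (Nat.lt_succ_iff.1 (Finset.mem_range.1 hi))]
    field_simp
  rw [Finset.sum_congr rfl h2, ← Finset.mul_sum, h', mul_zero]

/-- Applying Hobson's formula to every `Δ^i f` collects, at `Δ^t f`, the alternating sum
`∑_{i + j = t} (-1)^i / (i! j!)`, which vanishes unless `t = 0`. -/
theorem momentMap_invMoment {w : ι → ℝ} {z : ι → E d} (hd : 1 ≤ d) (hz : ∀ c, ‖z c‖ = 1)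
    {k n : ℕ} (hkn : k ≤ n)
    (hmom : ∀ N ≤ n + k, momentMap w z (2 * N) 1 =
      ((2 * N).factorial / N.factorial * momentConst d N : ℝ) • rsq d ^ N)
    {f : MvPolynomial (Fin d) ℝ} (hf : f.IsHomogeneous (2 * k)) :
    momentMap w z (2 * n) (invMoment d k (n + k) f) =
      ((2 * n).factorial * momentConst d (n + k) * 4 ^ k / (n - k).factorial : ℝ) •
        (rsq d ^ (n - k) * f) := by
  have hrsq : ∀ i (g : MvPolynomial (Fin d) ℝ),
      momentMap w z (2 * n) (rsq d ^ i * g) = momentMap w z (2 * n) g := by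
    intro i g
    simp [momentMap_apply, eval_rsq, hz]
  let F : ℕ → ℕ → MvPolynomial (Fin d) ℝ := fun i j =>
    ((-1) ^ i / (i.factorial * j.factorial) *
      ((2 * n).factorial * momentConst d (n + k) * (4 ^ k / 4 ^ (i + j) /
        (n - k + (i + j)).factorial)) : ℝ) • (rsq d ^ (n - k + (i + j)) * (lap d ^ (i + j)) f)
  have hterm : ∀ i ∈ Finset.range (k + 1), momentMap w z (2 * n)
      (((-1) ^ i * invCoeff d (n + k) i) • (rsq d ^ i * (lap d ^ i) f)) =
      ∑ j ∈ Finset.range (k + 1 - i), F i j := by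
    intro i hi
    have hik : i ≤ k := Nat.lt_succ_iff.1 (Finset.mem_range.1 hi)
    have h := momentMap_eq_hobson (w := w) (z := z) (N := n + k - i) (s := 2 * k - 2 * i)
      (J := k + 1 - i) (hmom _ (by omega)) (by omega) (by omega) (isHomogeneous_lap_pow hf i)
    rw [show 2 * (n + k - i) - (2 * k - 2 * i) = 2 * n by omega,
      show n + k - i - (2 * k - 2 * i) = n - k + i by omega] at h
    rw [map_smul, hrsq, h, hobson_apply, Finset.smul_sum, Finset.smul_sum]
    refine Finset.sum_congr rfl fun j hj => ?_
    have hne := (momentConst_pos hd (n + k - i)).ne'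
    rw [smul_smul, smul_smul, ← Module.End.mul_apply, ← pow_add, add_comm j i, add_assoc]
    simp only [F]
    congr 1
    have h4 : (2 : ℝ) ^ (2 * k - 2 * i) = 4 ^ k / 4 ^ i := by
      rw [eq_div_iff (by positivity), show (4 : ℝ) = 2 ^ 2 by norm_num, ← pow_mul, ← pow_mul,
        ← pow_add]
      congr 1
      omega
    rw [h4, invCoeff, pow_add (4 : ℝ)]
    field_simp
  rw [invMoment_apply, map_sum, Finset.sum_congr rfl hterm,
    ← Finset.sum_range_diag_flip (k + 1) F, Finset.sum_range_succ', Finset.sum_eq_zero]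
  · simp [F]
    congr 1
    ring
  · intro t _
    have hF : ∀ i ∈ Finset.range (t + 1 + 1), F i (t + 1 - i) =
        ((-1) ^ i / (i.factorial * (t + 1 - i).factorial) : ℝ) •
        (((2 * n).factorial * momentConst d (n + k) * (4 ^ k / 4 ^ (t + 1) /
        (n - k + (t + 1)).factorial) : ℝ) • (rsq d ^ (n - k + (t + 1)) *
          (lap d ^ (t + 1)) f)) := by
      intro i hi
      have : i + (t + 1 - i) = t + 1 := by have := Finset.mem_range.1 hi; omega
      simp only [F, this, smul_smul]
    rw [Finset.sum_congr rfl hF, ← Finset.sum_smul,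
      sum_neg_one_pow_div_factorial (Nat.succ_ne_zero t), zero_smul]

end Moments

open MvPolynomial

/-! ### Positivity of the inverse moment map -/

section Positivity

variable {d k n : ℕ}

lemma eval_invMoment {N : ℕ} {x : E d} (hx : ‖x‖ = 1) (f : MvPolynomial (Fin d) ℝ) :
    eval x.ofLp (invMoment d k N f) = ∑ i ∈ Finset.range (k + 1),
      (-1) ^ i * invCoeff d N i * eval x.ofLp ((lap d ^ i) f) := by
  rw [invMoment_apply, map_sum]
  refine Finset.sum_congr rfl fun i _ => ?_
  rw [smul_eval, map_mul, map_pow, eval_rsq, hx]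
  simp

lemma invCoeff_zero (hd : 1 ≤ d) (N : ℕ) : invCoeff d N 0 = 1 := by
  simp [invCoeff, (momentConst_pos hd N).ne']

/-- The elementary comparison behind `abs_lap_pow_le`: consecutive terms of the inverse series
are bounded by those of an exponential series. -/
lemma descending_ratio_le (hd : 1 ≤ d) (hkn : k ≤ n) {j : ℕ} (hj : j < k) :
    ((2 * k - 2 * j - 1) * (2 * k - 2 * j) : ℝ) ≤
      2 * k * (2 * k - 1) / (4 * (n + k) - 4 + 2 * d) * (4 * (n + k - j - 1) + 2 * d) := by
  have hd' : (1 : ℝ) ≤ d := by exact_mod_cast hd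
  have hkn' : (k : ℝ) ≤ n := by exact_mod_cast hkn
  have hj' : (j : ℝ) + 1 ≤ k := by exact_mod_cast hj
  have hj0 : (0 : ℝ) ≤ j := by positivity
  set q : ℝ := 4 * (n + k) - 4 + 2 * d with hq
  have hq8 : 8 * (k : ℝ) - 2 ≤ q := by rw [hq]; linarith
  have hq0 : 0 < q := by linarith
  rw [div_mul_eq_mul_div, le_div_iff₀ hq0,
    show (4 * ((n : ℝ) + k - j - 1) + 2 * d) = q - 4 * j by rw [hq]; ring]
  have h1 : (8 * (k : ℝ) - 2) * (2 * k + 1) ≤ q * (4 * k - 1 - 2 * j) :=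
    mul_le_mul hq8 (by linarith) (by linarith) hq0.le
  have h2 : 4 * (k : ℝ) * (2 * k - 1) ≤ q * (4 * k - 1 - 2 * j) := by nlinarith
  nlinarith [mul_le_mul_of_nonneg_left h2 hj0]

/-- Kellogg's inequality iterated, with the constants of the inverse of the moment map. -/
lemma abs_lap_pow_le (hd : 1 ≤ d) (hkn : k ≤ n) {f : MvPolynomial (Fin d) ℝ}
    (hf : f.IsHomogeneous (2 * k)) {B : ℝ} (hB : ∀ x : E d, ‖x‖ = 1 → |eval x.ofLp f| ≤ B)
    {j : ℕ} (hj : j ≤ k) (x : E d) (hx : ‖x‖ = 1) :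
    momentConst d (n + k) * |eval x.ofLp ((lap d ^ j) f)| ≤
      momentConst d (n + k - j) *
        (B * (d * (2 * k * (2 * k - 1) / (4 * (n + k) - 4 + 2 * d))) ^ j) := by
  have hB0 : 0 ≤ B := (abs_nonneg _).trans (hB x hx)
  induction j generalizing x with
  | zero =>
    simpa using mul_le_mul_of_nonneg_left (hB x hx) (momentConst_pos hd (n + k)).le
  | succ j ih =>
    set r : ℝ := 2 * k * (2 * k - 1) / (4 * (n + k) - 4 + 2 * d) with hr
    set β := momentConst d (n + k) with hβ
    have hβ0 : 0 < β := momentConst_pos hd _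
    have hih : ∀ y : E d, ‖y‖ = 1 → |eval y.ofLp ((lap d ^ j) f)| ≤
        momentConst d (n + k - j) * (B * (d * r) ^ j) / β := by
      intro y hy
      rw [le_div_iff₀ hβ0, mul_comm]
      exact ih (by omega) y hy
    have h := abs_eval_lap_le (isHomogeneous_lap_pow hf j) hih x hx
    rw [← Module.End.mul_apply, ← pow_succ'] at h
    have hc1 : ((2 * k - 2 * j - 1 : ℕ) : ℝ) = 2 * k - 2 * j - 1 := by
      rw [Nat.cast_sub (by omega), Nat.cast_sub (by omega)]; push_cast; ring
    have hc2 : ((2 * k - 2 * j : ℕ) : ℝ) = 2 * k - 2 * j := by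
      rw [Nat.cast_sub (by omega)]; push_cast; ring
    rw [hc1, hc2] at h
    obtain ⟨e, he⟩ : ∃ e, n + k - j = e + 1 := ⟨n + k - j - 1, by omega⟩
    have hee : n + k - (j + 1) = e := by omega
    have hce : (e : ℝ) = n + k - j - 1 := by
      have : (n + k : ℝ) = e + 1 + j := by exact_mod_cast (by omega : n + k = e + 1 + j)
      linarith
    have hmc := momentConst_succ (d := d) e
    have hratio := descending_ratio_le hd hkn (show j < k by omega)
    rw [← hr, ← hce] at hratio
    have hd' : (1 : ℝ) ≤ d := by exact_mod_cast hd
    have hpos : (0 : ℝ) < 4 * e + 2 * d := by positivity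
    have hk1 : (1 : ℝ) ≤ k := by exact_mod_cast (show 1 ≤ k by omega)
    have hr0 : 0 ≤ r := by
      have hn0 : (0 : ℝ) ≤ n := by positivity
      exact div_nonneg (mul_nonneg (by positivity) (by linarith)) (by linarith)
    have hce0 : 0 < momentConst d e := momentConst_pos hd e
    rw [he, hmc] at h
    rw [hee]
    calc β * |eval x.ofLp ((lap d ^ (j + 1)) f)|
        ≤ β * (d * ((2 * k - 2 * j - 1) * ((2 * k - 2 * j) *
          (momentConst d e * (4 * e + 2 * d : ℝ)⁻¹ * (B * (d * r) ^ j) / β)))) := by gcongr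
      _ = d * (momentConst d e * (4 * e + 2 * d : ℝ)⁻¹ * (B * (d * r) ^ j)) *
          ((2 * k - 2 * j - 1) * (2 * k - 2 * j)) := by
        field_simp
      _ ≤ d * (momentConst d e * (4 * e + 2 * d : ℝ)⁻¹ * (B * (d * r) ^ j)) *
          (r * (4 * e + 2 * d)) := by
        gcongr
      _ = momentConst d e * (B * (d * r) ^ (j + 1)) := by
        field_simp
        ring

/-- The inverse series is dominated by `f(x) - B (exp a - 1)`, and the hypothesis on `n` says
precisely that `exp a ≤ 1 + b / B`. -/
theorem eval_invMoment_nonneg (hd : 1 ≤ d) (hkn : k ≤ n) {f : MvPolynomial (Fin d) ℝ}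
    (hf : f.IsHomogeneous (2 * k)) {b B : ℝ} (hb : 0 < b)
    (hfb : ∀ x : E d, ‖x‖ = 1 → b ≤ eval x.ofLp f)
    (hfB : ∀ x : E d, ‖x‖ = 1 → eval x.ofLp f ≤ B)
    (hn : (2 * n : ℝ) ≥ d * k * (2 * k - 1) / Real.log (1 + b / B) + 2 - 2 * k - d)
    {x : E d} (hx : ‖x‖ = 1) : 0 ≤ eval x.ofLp (invMoment d k (n + k) f) := by
  have hB0 : 0 < B := hb.trans_le ((hfb x hx).trans (hfB x hx))
  have habs : ∀ x : E d, ‖x‖ = 1 → |eval x.ofLp f| ≤ B := fun x hx => by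
    rw [abs_of_pos (hb.trans_le (hfb x hx))]; exact hfB x hx
  set a : ℝ := d * (2 * k * (2 * k - 1) / (4 * (n + k) - 4 + 2 * d)) with ha
  have ha_le : 0 ≤ a ∧ a ≤ Real.log (1 + b / B) := by
    have hlog : 0 < Real.log (1 + b / B) := Real.log_pos (by linarith [div_pos hb hB0])
    rcases Nat.eq_zero_or_pos k with rfl | hk
    · have : a = 0 := by simp [ha]
      rw [this]; exact ⟨le_rfl, hlog.le⟩
    · have hk1 : (1 : ℝ) ≤ k := by exact_mod_cast hk
      have hd' : (1 : ℝ) ≤ d := by exact_mod_cast hd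
      have hkn' : (k : ℝ) ≤ n := by exact_mod_cast hkn
      have hq : (0 : ℝ) < 2 * n + 2 * k + d - 2 := by linarith
      have ha' : a = d * k * (2 * k - 1) / (2 * n + 2 * k + d - 2) := by
        rw [ha, show (4 * ((n : ℝ) + k) - 4 + 2 * d) = 2 * (2 * n + 2 * k + d - 2) by ring]
        field_simp
      have h2k : (0 : ℝ) ≤ 2 * k - 1 := by linarith
      have hn' : d * k * (2 * k - 1) / Real.log (1 + b / B) ≤ 2 * n + 2 * k + d - 2 := by linarith
      rw [ha']
      refine ⟨by positivity, ?_⟩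
      rw [div_le_iff₀ hq]
      rwa [div_le_iff₀ hlog, mul_comm (_ - _) (Real.log _)] at hn'
  have hexp : B * (Real.exp a - 1) ≤ b := by
    have h1 : Real.exp a ≤ 1 + b / B := by
      rw [← Real.le_log_iff_exp_le (by positivity)]; exact ha_le.2
    calc B * (Real.exp a - 1) ≤ B * (b / B) := by gcongr; linarith
      _ = b := by field_simp
  rw [eval_invMoment hx, Finset.sum_range_succ', invCoeff_zero hd]
  have hterm : ∀ i ∈ Finset.range k, -(B * (a ^ (i + 1) / (i + 1).factorial)) ≤
      (-1) ^ (i + 1) * invCoeff d (n + k) (i + 1) * eval x.ofLp ((lap d ^ (i + 1)) f) := by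
    intro i hi
    refine (abs_le.1 ?_).1
    have h := abs_lap_pow_le hd hkn hf habs (j := i + 1)
      (by have := Finset.mem_range.1 hi; omega) x hx
    rw [← ha] at h
    have hc := momentConst_pos hd (n + k - (i + 1))
    have hc0 := momentConst_pos hd (n + k)
    rw [abs_mul, abs_mul, abs_pow, abs_neg, abs_one, one_pow, one_mul, invCoeff,
      abs_of_nonneg (by positivity), div_mul_eq_mul_div, div_le_iff₀ (by positivity)]
    refine h.trans_eq ?_
    field_simp
  have hsum := Finset.sum_le_sum hterm
  have hpart := Real.sum_le_exp_of_nonneg ha_le.1 (k + 1)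
  rw [Finset.sum_range_succ'] at hpart
  rw [Finset.sum_neg_distrib, ← Finset.mul_sum] at hsum
  have hmul := mul_le_mul_of_nonneg_left hpart hB0.le
  simp only [pow_zero, Nat.factorial_zero, Nat.cast_one, div_one, mul_add, mul_one] at hmul
  have hfx := hfb x hx
  simp only [pow_zero, one_mul, Module.End.one_apply]
  linarith

/-- For a quadratic form the inverse is `f - ‖x‖² Δf / (4n + 2d)`, so that an upper bound of `Δf`
suffices. -/
theorem eval_invMoment_nonneg_of_quadratic (hd : 1 ≤ d) {f : MvPolynomial (Fin d) ℝ}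
    (hf : f.IsHomogeneous 2) {b B : ℝ} (hb : 0 < b)
    (hfb : ∀ x : E d, ‖x‖ = 1 → b ≤ eval x.ofLp f)
    (hfB : ∀ x : E d, ‖x‖ = 1 → eval x.ofLp f ≤ B)
    (hn : (2 * n : ℝ) ≥ d * (B / b) - d) {x : E d} (hx : ‖x‖ = 1) :
    0 ≤ eval x.ofLp (invMoment d 1 (n + 1) f) := by
  have habs : ∀ x : E d, ‖x‖ = 1 → |eval x.ofLp f| ≤ B := fun x hx => by
    rw [abs_of_pos (hb.trans_le (hfb x hx))]; exact hfB x hx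
  have hlap := (abs_le.1 (abs_eval_lap_le hf habs x hx)).2
  have hd' : (1 : ℝ) ≤ d := by exact_mod_cast hd
  have hcoef : invCoeff d (n + 1) 1 = (4 * n + 2 * d : ℝ)⁻¹ := by
    have := (momentConst_pos hd n).ne'
    rw [invCoeff, Nat.add_sub_cancel, momentConst_succ]
    field_simp
    simp
  rw [eval_invMoment hx, Finset.sum_range_succ, Finset.sum_range_one, invCoeff_zero hd, hcoef]
  simp only [pow_zero, one_mul, Module.End.one_apply, pow_one]
  have hpos : (0 : ℝ) < 4 * n + 2 * d := by positivity
  have h1 : d * B ≤ b * (2 * n + d) := by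
    have h2 : d * (B / b) ≤ 2 * n + d := by linarith
    calc d * B = b * (d * (B / b)) := by field_simp
      _ ≤ b * (2 * n + d) := by gcongr
  have h3 : (4 * n + 2 * d : ℝ)⁻¹ * eval x.ofLp (lap d f) ≤ b := by
    rw [inv_mul_le_iff₀ hpos]
    push_cast at hlap
    linarith
  linarith [hfb x hx]

end Positivity

/-! ### Homogeneity and extremal values of biforms -/

section Biforms

variable {r l d D : ℕ}

lemma eval_smul_toPoly {n : ℕ} (c : ℝ) (x : E d) (t : ⨂[ℝ]^n (E d)) :
    eval (c • x).ofLp (toPoly n d t) = c ^ n * eval x.ofLp (toPoly n d t) := by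
  rw [← polar_diag, ← polar_diag, MultilinearMap.map_smul_univ (polar n d t) (fun _ => c)]
  simp

lemma p_smul_left (v : Sym r d ⊗[ℝ] Sym l D) (c : ℝ) (x : E d) (y : E D) :
    p v (c • x) y = c ^ r * p v x y := by
  rw [p_eq_eval_contrRight, p_eq_eval_contrRight, eval_smul_toPoly]

lemma p_smul_right (v : Sym r d ⊗[ℝ] Sym l D) (c : ℝ) (x : E d) (y : E D) :
    p v x (c • y) = c ^ l * p v x y := by
  rw [p_eq_eval_contrLeft, p_eq_eval_contrLeft, eval_smul_toPoly]

lemma exists_unit_smul_eq (hd : 1 ≤ d) (x : E d) : ∃ u : E d, ‖u‖ = 1 ∧ x = ‖x‖ • u := by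
  have : Nonempty (Fin d) := ⟨⟨0, hd⟩⟩
  by_cases hx : x = 0
  · obtain ⟨e, he⟩ := exists_norm_eq (E d) zero_le_one
    exact ⟨e, he, by simp [hx]⟩
  · refine ⟨‖x‖⁻¹ • x, norm_smul_inv_norm (𝕜 := ℝ) hx, ?_⟩
    rw [smul_smul, mul_inv_cancel₀ (norm_ne_zero_iff.2 hx), one_smul]

lemma continuous_p (v : Sym r d ⊗[ℝ] Sym l D) :
    Continuous fun q : E d × E D => p v q.1 q.2 := by
  have hbra : ∀ {n e : ℕ} (t : ⨂[ℝ]^n (E e)), Continuous fun x : E e => bra n x t := by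
    intro n e t
    have h : (fun x : E e => bra n x t) = fun x => polar n e t fun _ => x := by
      funext x; rw [polar_diag, eval_toPoly]
    rw [h]
    exact (continuous_polar t).comp (by fun_prop)
  induction v using TensorProduct.induction_on with
  | zero => simpa [p] using continuous_const
  | tmul a b =>
    have h : (fun q : E d × E D => p (a ⊗ₜ[ℝ] b) q.1 q.2) = fun q => bra r q.1 a * bra l q.2 b := by
      funext q; simp [p]
    rw [h]
    exact ((hbra (a : ⨂[ℝ]^r (E d))).comp continuous_fst).mul
      ((hbra (b : ⨂[ℝ]^l (E D))).comp continuous_snd)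
  | add a b ha hb =>
    have h : (fun q : E d × E D => p (a + b) q.1 q.2) =
        fun q => p a q.1 q.2 + p b q.1 q.2 := by
      funext q; simp [p]
    rw [h]
    exact ha.add hb

lemma isCompact_sphereValues (v : Sym r d ⊗[ℝ] Sym l D) : IsCompact (sphereValues v) := by
  have h : sphereValues v = (fun q : E d × E D => p v q.1 q.2) ''
      (Metric.sphere 0 1 ×ˢ Metric.sphere 0 1) := by
    ext s
    simp only [sphereValues, Set.mem_ofPred_eq, Set.mem_image, Set.mem_prod, Prod.exists,
      mem_sphere_zero_iff_norm]
    constructor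
    · rintro ⟨x, y, hx, hy, rfl⟩; exact ⟨x, y, ⟨hx, hy⟩, rfl⟩
    · rintro ⟨x, y, ⟨hx, hy⟩, rfl⟩; exact ⟨x, y, hx, hy, rfl⟩
  rw [h]
  exact ((isCompact_sphere _ _).prod (isCompact_sphere _ _)).image (continuous_p v)

lemma m_le_p (v : Sym r d ⊗[ℝ] Sym l D) {x : E d} {y : E D} (hx : ‖x‖ = 1) (hy : ‖y‖ = 1) :
    m v ≤ p v x y :=
  csInf_le (isCompact_sphereValues v).bddBelow ⟨x, y, hx, hy, rfl⟩

lemma p_le_M (v : Sym r d ⊗[ℝ] Sym l D) {x : E d} {y : E D} (hx : ‖x‖ = 1) (hy : ‖y‖ = 1) :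
    p v x y ≤ M v :=
  le_csSup (isCompact_sphereValues v).bddAbove ⟨x, y, hx, hy, rfl⟩

end Biforms

/-! ### Sums of squares -/

section SumsOfSquares

variable {d D : ℕ}

open scoped MatrixOrder in
/-- A positive semidefinite real quadratic form is a sum of squares of linear forms. -/
lemma exists_sq_of_posSemidef {A : Matrix (Fin D) (Fin D) ℝ} (hA : A.PosSemidef) :
    ∃ B : Matrix (Fin D) (Fin D) ℝ, ∀ y : Fin D → ℝ,
      y ⬝ᵥ A.mulVec y = ∑ i, (B.mulVec y i) ^ 2 := by
  obtain ⟨B, rfl⟩ := CStarAlgebra.nonneg_iff_eq_star_mul_self.mp hA.nonneg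
  refine ⟨B, fun y => ?_⟩
  rw [← Matrix.mulVec_mulVec, Matrix.dotProduct_mulVec, Matrix.star_eq_conjTranspose,
    Matrix.conjTranspose_eq_transpose_of_trivial, Matrix.vecMul_transpose, dotProduct]
  simp only [sq]

/-- A nonnegative form of degree at most two is a sum of squares. -/
lemma exists_sq_of_nonneg {l : ℕ} (hl : l ≤ 2) {P : MvPolynomial (Fin D) ℝ}
    (hP : P.IsHomogeneous l) (hpos : ∀ y : Fin D → ℝ, 0 ≤ eval y P) :
    ∃ (N : ℕ) (s : Fin N → MvPolynomial (Fin D) ℝ),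
      ∀ y : Fin D → ℝ, eval y P = ∑ i, (eval y (s i)) ^ 2 := by
  have heuler : ∀ {l : ℕ} {Q : MvPolynomial (Fin D) ℝ} (_ : Q.IsHomogeneous l) (y : Fin D → ℝ),
      ∑ i, y i * eval y (pderiv i Q) = l * eval y Q := by
    intro l Q hQ y
    have := congrArg (eval y) hQ.sum_X_mul_pderiv
    simpa using this
  have hconst : ∀ {Q : MvPolynomial (Fin D) ℝ}, Q.IsHomogeneous 0 →
      ∀ y, eval y Q = coeff 0 Q := by
    intro Q hQ y
    rw [← totalDegree_zero_iff_isHomogeneous, totalDegree_eq_zero_iff_eq_C] at hQ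
    conv_lhs => rw [hQ, eval_C]
  interval_cases l
  · refine ⟨1, fun _ => C (√(coeff 0 P)), fun y => ?_⟩
    have h := hpos 0
    rw [hconst hP] at h
    simp [hconst hP, Real.sq_sqrt h]
  · -- A nonnegative linear form vanishes.
    refine ⟨0, Fin.elim0, fun y => ?_⟩
    have h1 := heuler hP
    have hlin : ∀ i y, eval y (pderiv i P) = coeff 0 (pderiv i P) := fun i =>
      hconst hP.pderiv
    simp only [hlin, Nat.cast_one, one_mul] at h1
    have hneg : eval (-y) P = -eval y P := by
      rw [← h1, ← h1]; simp
    have h2 := hpos y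
    have h3 := hpos (-y)
    rw [hneg] at h3
    simp only [Finset.univ_eq_empty, Finset.sum_empty]
    linarith
  · let A : Matrix (Fin D) (Fin D) ℝ := fun i j => coeff 0 (pderiv i (pderiv j P)) / 2
    have hA : ∀ y, eval y P = y ⬝ᵥ A.mulVec y := by
      intro y
      have h1 := heuler hP y
      have h2 : ∀ i, eval y (pderiv i P) = ∑ j, y j * coeff 0 (pderiv j (pderiv i P)) := by
        intro i
        have := heuler (hP.pderiv (i := i)) y
        rw [← one_mul (eval y (pderiv i P)), show (1 : ℝ) = ((2 - 1 : ℕ) : ℝ) by norm_num, ← this]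
        exact Finset.sum_congr rfl fun j _ => by
          rw [hconst (Q := pderiv j (pderiv i P)) (hP.pderiv.pderiv)]
      have h3 : eval y P = (∑ i, y i * eval y (pderiv i P)) / 2 := by rw [h1]; push_cast; ring
      rw [h3, dotProduct, Finset.sum_div]
      refine Finset.sum_congr rfl fun i _ => ?_
      rw [h2, mul_div_assoc, Finset.sum_div, Matrix.mulVec, dotProduct]
      congr 1
      refine Finset.sum_congr rfl fun j _ => ?_
      simp only [A, pderiv_comm i j]
      ring
    have hpsd : A.PosSemidef := by
      refine Matrix.PosSemidef.of_dotProduct_mulVec_nonneg ?_ fun y => ?_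
      · ext i j
        change A j i = A i j
        simp only [A, pderiv_comm i j]
      · rw [star_trivial, ← hA]; exact hpos y
    obtain ⟨B, hB⟩ := exists_sq_of_posSemidef hpsd
    refine ⟨D, fun i => ∑ j, C (B i j) * X j, fun y => ?_⟩
    rw [hA, hB]
    refine Finset.sum_congr rfl fun i _ => ?_
    simp [Matrix.mulVec, dotProduct]

lemma isSumOfSquares_of_fintype {κ : Type*} [Fintype κ] {f : E d → E D → ℝ}
    (s : κ → MvPolynomial (Fin d ⊕ Fin D) ℝ)
    (h : ∀ x y, f x y = ∑ i, (eval (Sum.elim (fun a => x a) (fun b => y b)) (s i)) ^ 2) :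
    IsSumOfSquares f := by
  refine ⟨Fintype.card κ, s ∘ (Fintype.equivFin κ).symm, fun x y => ?_⟩
  rw [h]
  exact (Equiv.sum_comp (Fintype.equivFin κ).symm
    fun i => (eval (Sum.elim (fun a => x a) (fun b => y b)) (s i)) ^ 2).symm

end SumsOfSquares

end RealPSS

/-! ### The integral representation of positive biforms -/

open RealPSS MvPolynomial in
theorem theorem4p2 (d D k l : ℕ) (hd : 1 ≤ d) (hD : 1 ≤ D) (hl : l ≤ 2)
    (v : RealPSS.Sym (2 * k) d ⊗[ℝ] RealPSS.Sym l D) (hm : 0 < RealPSS.m v)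
    (n : ℕ) (hkn : k ≤ n)
    (hn : (2 * n : ℝ) ≥
          d * k * (2 * k - 1) / Real.log (1 + RealPSS.m v / RealPSS.M v) + 2 - 2 * k - d ∨
        (k = 1 ∧ (2 * n : ℝ) ≥ d * (RealPSS.M v / RealPSS.m v) - d)) :
    (∃ v' : RealPSS.Sym (2 * k) d ⊗[ℝ] RealPSS.Sym l D,
      (∀ (x : RealPSS.E d) (y : RealPSS.E D),
        ‖x‖ ^ (2 * (n - k)) * RealPSS.p v x y =
          ∫ φ : Metric.sphere (0 : RealPSS.E d) 1,
            RealPSS.p v' (φ : RealPSS.E d) y * (inner ℝ (φ : RealPSS.E d) x) ^ (2 * n)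
              ∂(RealPSS.uniformSphere d)) ∧
      (∀ (φ : RealPSS.E d) (y : RealPSS.E D), 0 ≤ RealPSS.p v' φ y)) ∧
    RealPSS.IsSumOfSquares
      (fun (x : RealPSS.E d) (y : RealPSS.E D) => ‖x‖ ^ (2 * (n - k)) * RealPSS.p v x y) := by
  obtain ⟨ι, _, w, z, hw0, hw1, hz, hcub⟩ := exists_cubature hd (2 * (n + k))
  -- The nodes reproduce the even moments of the uniform measure.
  have hmom : ∀ N ≤ n + k, momentMap w z (2 * N) 1 =
      ((2 * N).factorial / N.factorial * momentConst d N : ℝ) • rsq d ^ N := by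
    intro N hN
    refine momentMap_one (N₀ := n + k) hd hw1 hz (fun N hN => ?_) hN
    obtain ⟨c, hc⟩ := exists_integral_inner_pow hd (2 * N)
    refine ⟨c, MvPolynomial.funext fun x' => ?_⟩
    set x : E d := WithLp.toLp 2 x' with hx
    change eval x.ofLp _ = eval x.ofLp _
    have hcub' := hcub (linPoly d x ^ (2 * N))
      ((((isHomogeneous_linPoly x).pow (2 * N)).totalDegree_le).trans (by omega))
    have hcx := hc x
    simp only [map_pow, eval_linPoly] at hcub'
    simp only [real_inner_comm x] at hcub' hcx
    rw [smul_eval, map_pow, eval_rsq, ← pow_mul, ← hcx, hcub', momentMap_apply, map_sum]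
    refine Finset.sum_congr rfl fun i _ => ?_
    rw [smul_eval, map_pow, eval_linPoly, map_one, mul_one, real_inner_comm]
  obtain ⟨S, hS⟩ := exists_symMap (n := 2 * k) (invMoment d k (n + k))
    fun P hP => isHomogeneous_invMoment hP
  set c₀ : ℝ := (2 * n).factorial * momentConst d (n + k) * 4 ^ k / (n - k).factorial with hc₀
  have hc₀pos : 0 < c₀ := by
    have := momentConst_pos hd (n + k)
    positivity
  -- The normalization `c₀` is the factor by which `momentMap ∘ invMoment` multiplies.
  let v' : RealPSS.Sym (2 * k) d ⊗[ℝ] RealPSS.Sym l D := c₀⁻¹ • TensorProduct.map S LinearMap.id v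
  let f : E D → MvPolynomial (Fin d) ℝ := fun y =>
    toPoly (2 * k) d (contrRight (2 * k) d y v : ⨂[ℝ]^(2 * k) (E d))
  have hfhom : ∀ y, (f y).IsHomogeneous (2 * k) := fun y => isHomogeneous_toPoly _
  have hpv : ∀ x y, p v x y = eval x.ofLp (f y) := fun x y => p_eq_eval_contrRight v x y
  have hpv' : ∀ x y, p v' x y = c₀⁻¹ * eval x.ofLp (invMoment d k (n + k) (f y)) := by
    intro x y
    simp only [p_eq_eval_contrRight, v', f]
    rw [map_smul, contrRight_map, Submodule.coe_smul, map_smul, smul_eval, hS]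
  have hnonneg : ∀ (φ : E d) (y : E D), 0 ≤ p v' φ y := by
    intro φ y
    obtain ⟨u, hu, hφ⟩ := exists_unit_smul_eq hd φ
    obtain ⟨e, he, hy⟩ := exists_unit_smul_eq hD y
    rw [hφ, hy, p_smul_left, p_smul_right]
    refine mul_nonneg (by positivity) (mul_nonneg (by positivity) ?_)
    rw [hpv']
    refine mul_nonneg (by positivity) ?_
    have hlow : ∀ x : E d, ‖x‖ = 1 → m v ≤ eval x.ofLp (f e) := fun x hx => by
      rw [← hpv]; exact m_le_p v hx he
    have hupp : ∀ x : E d, ‖x‖ = 1 → eval x.ofLp (f e) ≤ M v := fun x hx => by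
      rw [← hpv]; exact p_le_M v hx he
    rcases hn with hn | ⟨rfl, hn⟩
    · exact eval_invMoment_nonneg hd hkn (hfhom e) hm hlow hupp hn hu
    · exact eval_invMoment_nonneg_of_quadratic hd (hfhom e) hm hlow hupp hn hu
  have hsum : ∀ (x : E d) (y : E D), ‖x‖ ^ (2 * (n - k)) * p v x y =
      ∑ c, w c * (p v' (z c) y * (inner ℝ (z c) x) ^ (2 * n)) := by
    intro x y
    have h := congrArg (eval x.ofLp) (momentMap_invMoment hd hz hkn hmom (hfhom y))
    rw [smul_eval, ← hc₀, map_mul, map_pow, eval_rsq, ← pow_mul, momentMap_apply, map_sum] at h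
    rw [hpv, eq_comm, ← mul_right_inj' hc₀pos.ne', ← h, Finset.mul_sum]
    refine Finset.sum_congr rfl fun c _ => ?_
    rw [smul_eval, map_pow, eval_linPoly, hpv']
    field_simp
  refine ⟨⟨v', fun x y => ?_, hnonneg⟩, ?_⟩
  · have hdeg : ((c₀⁻¹ • invMoment d k (n + k) (f y)) * linPoly d x ^ (2 * n)).totalDegree ≤
        2 * (n + k) := by
      have h1 : (c₀⁻¹ • invMoment d k (n + k) (f y)).IsHomogeneous (2 * k) := by
        rw [smul_eq_C_mul]; exact (isHomogeneous_invMoment (hfhom y)).C_mul _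
      exact ((h1.mul ((isHomogeneous_linPoly x).pow (2 * n))).totalDegree_le).trans (by omega)
    have h := hcub _ hdeg
    simp only [map_mul, smul_eval, map_pow, eval_linPoly, ← hpv'] at h
    rw [hsum]
    simp only [real_inner_comm x]
    exact h.symm
  · have hsq : ∀ c, ∃ (N : ℕ) (s : Fin N → MvPolynomial (Fin D) ℝ),
        ∀ y : E D, p v' (z c) y = ∑ i, (eval y.ofLp (s i)) ^ 2 := by
      intro c
      obtain ⟨N, s, hs⟩ := exists_sq_of_nonneg hl
        (isHomogeneous_toPoly (contrLeft l D (z c) v' : ⨂[ℝ]^l (E D))) fun y => by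
          have := hnonneg (z c) (WithLp.toLp 2 y)
          rwa [p_eq_eval_contrLeft] at this
      exact ⟨N, s, fun y => by rw [p_eq_eval_contrLeft, hs]⟩
    choose N s hs using hsq
    refine isSumOfSquares_of_fintype (κ := Σ c, Fin (N c)) (fun q =>
      C (√(w q.1)) * rename Sum.inr (s q.1 q.2) *
        rename Sum.inl (linPoly d (z q.1)) ^ n) fun x y => ?_
    rw [hsum, Fintype.sum_sigma]
    refine Finset.sum_congr rfl fun c _ => ?_
    rw [hs, Finset.sum_mul, Finset.mul_sum]
    refine Finset.sum_congr rfl fun i _ => ?_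
    have h1 : eval (Sum.elim (fun a => x a) (fun b => y b)) (rename Sum.inr (s c i)) =
        eval y.ofLp (s c i) := by rw [eval_rename]; rfl
    have h2 : eval (Sum.elim (fun a => x a) (fun b => y b))
        (rename Sum.inl (linPoly d (z c))) = inner ℝ (z c) x := by
      rw [eval_rename, ← eval_linPoly]; rfl
    simp only [map_mul, map_pow, eval_C, h1, h2, mul_pow]
    rw [Real.sq_sqrt (hw0 c), ← pow_mul, mul_comm n 2]
    ring
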